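/- Let $E$ be a complex Banach space, let $C\in L(E)$ be injective, and let $\mathcal D=C_0^\infty(\mathbb R)$ be the space of complex-valued test functions with its usual inductive limit topology, $\mathcal D_0=\{\varphi\in\mathcal D:\operatorname{supp}\varphi\subseteq[0,\infty)\}$. Let $\mathcal G:\mathcal D\to L(E)$ be a $C$-distribution semigroup, i.e. a continuous linear map (an $L(E)$-valued distribution) with support contained in $[0,\infty)$ such that $C\mathcal G(\varphi)=\mathcal G(\varphi)C$ and $\mathcal G(\varphi*_0\psi)C=\mathcal G(\varphi)\mathcal G(\psi)$ for all $\varphi,\psi\in\mathcal D$, where $(\varphi*_0\psi)(t)=\int_0^t\varphi(t-s)\psi(s)\,ds$ for $t\in\mathbb R$, and such that $\mathcal G(\varphi)x=0$ for all $\varphi\in\mathcal D_0$ implies $x=0$. For a scalar distribution $T$ with compact support in $[0,\infty)$ let $G(T)$ be the closed operator whose graph consists of all $(x,y)\in E\times E$ with $\mathcal G(T*\varphi)x=\mathcal G(\varphi)y$ for all $\varphi\in\mathcal D_0$, where $(T*\varphi)(t)=T(\varphi(t-\cdot))$. Let $A=G(-\delta')$ be the generator of $\mathcal G$, where $\delta_t(\varphi)=\varphi(t)$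 and $\delta=\delta_0$. Let $Z(A)$ be the set of all $x\in E$ for which there is a continuous $u:[0,\infty)\to E$ with $\int_0^tu(s)\,ds\in D(A)$ and $A\int_0^tu(s)\,ds=u(t)-x$ for all $t\ge0$. A continuous function $f$ from $[0,\infty)$ to a Banach space is called almost periodic if for every $\varepsilon>0$ there is $l>0$ such that every subinterval of $[0,\infty)$ of length $l$ contains some $\tau$ with $\|f(t+\tau)-f(t)\|\le\varepsilon$ for all $t\ge0$; a function $f:[0,\infty)\to E$ is weakly almost periodic if $x^*\circ f$ is almost periodic for every $x^*\in E^*$. For a linear subspace $V\subseteq Z(A)$, $\mathcal G$ is called $V$-(weakly) almost periodic if for every $x\in V$ the map $t\mapsto G(\delta_t)x$, $t\ge0$, is (weakly) almost periodic. Let $D$ be the set of all eigenvectors of $A$ corresponding to eigenvalues $ir$ with $r\in\mathbb R$ (including $r=0$). Suppose that $\tilde E$ is a linear subspace of $Z(A)$ such that $\mathcal G$ is $\tilde E$-weakly almost periodic, that $\tilde E$ is dense in $E$, and that $E$ is weakly sequentially complete (every weakly Cauchy sequence converges weakly). Then $D$ is total in $E$, i.e. the linear span of $D$ is dense in $E$.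 Moreover, $\operatorname{span}(D)\subseteq Z(A)$ and $\mathcal G$ is $\operatorname{span}(D)$-almost periodic. -/

import Mathlib

open scoped Distributions

namespace CDistSemigroup

/-- The Schwartz space `𝒟 = C₀^∞(ℝ)` of complex-valued test functions on the real line, with the
usual inductive limit topology. -/
abbrev TestFun : Type := 𝓓((⊤ : TopologicalSpace.Opens ℝ), ℂ)

/-- The subspace `𝒟₀ = 𝒟_{[0,∞)}` of test functions whose support is contained in `[0,∞)`. -/
def testFunNonneg : Set TestFun := {φ | tsupport (φ : ℝ → ℂ) ⊆ Set.Ici 0}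

/-! ### The truncated convolution product -/

/-- `φ *₀ ψ` as a function: `(φ *₀ ψ)(t) = ∫₀ᵗ φ(t - s) ψ(s) ds`, for every real `t`. -/
noncomputable def conv₀Fun (φ ψ : ℝ → ℂ) (t : ℝ) : ℂ := ∫ s in (0 : ℝ)..t, φ (t - s) * ψ s

open MeasureTheory Convolution in
theorem conv₀Fun_eq (φ ψ : TestFun) :
    conv₀Fun φ ψ = fun t =>
      ((Set.Ioi (0 : ℝ)).indicator ψ ⋆[ContinuousLinearMap.mul ℝ ℂ, volume] φ) t -
      ((Set.Iio (0 : ℝ)).indicator φ ⋆[ContinuousLinearMap.mul ℝ ℂ, volume] ψ) t := by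
  have hi : ∀ t : ℝ, Integrable (fun s => φ (t - s) * ψ s) volume := fun t =>
    Continuous.integrable_of_hasCompactSupport
      ((φ.continuous.comp (continuous_const.sub continuous_id)).mul ψ.continuous)
      (ψ.hasCompactSupport.mul_left)
  funext t
  have h1 : ((Set.Ioi (0 : ℝ)).indicator ψ ⋆[ContinuousLinearMap.mul ℝ ℂ, volume] φ) t
      = ∫ s in Set.Ioi (0 : ℝ), φ (t - s) * ψ s := by
    rw [convolution_def, ← integral_indicator measurableSet_Ioi]
    refine integral_congr_ae (Filter.Eventually.of_forall fun s => ?_)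
    by_cases hs : s ∈ Set.Ioi (0 : ℝ) <;> simp [hs, mul_comm]
  have h2 : ((Set.Iio (0 : ℝ)).indicator φ ⋆[ContinuousLinearMap.mul ℝ ℂ, volume] ψ) t
      = ∫ s in Set.Ioi t, φ (t - s) * ψ s := by
    rw [convolution_eq_swap, ← integral_indicator measurableSet_Ioi]
    refine integral_congr_ae (Filter.Eventually.of_forall fun s => ?_)
    by_cases hs : t < s <;> simp [hs]
  rw [h1, h2, conv₀Fun]
  exact (intervalIntegral.integral_Ioi_sub_Ioi' (hi t).integrableOn (hi t).integrableOn).symm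

theorem conv₀Fun_contDiff (φ ψ : TestFun) :
    ContDiff ℝ ((⊤ : ℕ∞) : WithTop ℕ∞) (conv₀Fun φ ψ) := by
  rw [conv₀Fun_eq]
  refine ContDiff.sub ?_ ?_
  · refine HasCompactSupport.contDiff_convolution_right _ φ.hasCompactSupport ?_ φ.contDiff
    exact (ψ.continuous.locallyIntegrable).indicator measurableSet_Ioi
  · refine HasCompactSupport.contDiff_convolution_right _ ψ.hasCompactSupport ?_ ψ.contDiff
    exact (φ.continuous.locallyIntegrable).indicator measurableSet_Iio

theorem conv₀Fun_hasCompactSupport (φ ψ : TestFun) : HasCompactSupport (conv₀Fun φ ψ) := by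
  refine HasCompactSupport.intro (φ.hasCompactSupport.isCompact.add ψ.hasCompactSupport.isCompact)
    fun t ht => ?_
  have : ∀ s, φ (t - s) * ψ s = 0 := by
    intro s
    by_contra h
    obtain ⟨h1, h2⟩ := mul_ne_zero_iff.1 h
    exact ht ⟨t - s, subset_tsupport _ h1, s, subset_tsupport _ h2, sub_add_cancel t s⟩
  simp [conv₀Fun, this]

/-- The product `φ *₀ ψ` of two test functions, which is again a test function. -/
noncomputable def conv₀ (φ ψ : TestFun) : TestFun where
  toFun := conv₀Fun φ ψ
  contDiff' := conv₀Fun_contDiff φ ψ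
  hasCompactSupport' := conv₀Fun_hasCompactSupport φ ψ
  tsupport_subset' := Set.subset_univ _

/-! ### Scalar distributions and their convolution with test functions -/

/-- The test function `φ(t - ·)`. -/
noncomputable def reflect (t : ℝ) (φ : TestFun) : TestFun where
  toFun := fun s => φ (t - s)
  contDiff' := φ.contDiff.comp (contDiff_const.sub contDiff_id)
  hasCompactSupport' := φ.hasCompactSupport.comp_homeomorph (Homeomorph.subLeft t)
  tsupport_subset' := Set.subset_univ _

/-- The convolution `T * φ` of a distribution and a test function: `(T * φ)(t) = T(φ(t - ·))`. -/
noncomputable def convolve (T : TestFun →L[ℂ] ℂ) (φ : TestFun) (t : ℝ) : ℂ := T (reflect t φ)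

/-- The Dirac distribution `δ_t(φ) = φ(t)`. -/
noncomputable def dirac (t : ℝ) : TestFun →L[ℂ] ℂ :=
  (BoundedContinuousFunction.evalCLM ℂ t).comp (TestFunction.toBoundedContinuousFunctionCLM ℂ)

/-- The distributional derivative `T'(φ) = -T(φ')`. -/
noncomputable def distDeriv (T : TestFun →L[ℂ] ℂ) : TestFun →L[ℂ] ℂ :=
  -(T.comp (TestFunction.lineDerivCLM ℂ (1 : ℝ) : TestFun →L[ℂ] TestFun))

variable {E : Type*} [NormedAddCommGroup E] [NormedSpace ℂ E]

/-! ### `C`-distribution semigroups -/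

/-- `𝒢 ∈ 𝒟'₀(L(E))` is a `C`-distribution semigroup. -/
structure IsCDistSemigroup (C : E →L[ℂ] E) (𝒢 : TestFun →L[ℂ] (E →L[ℂ] E)) : Prop where
  /-- the support of `𝒢` is contained in `[0,∞)` -/
  support_nonneg : Distribution.dsupport 𝒢 ⊆ Set.Ici (0 : ℝ)
  /-- `C𝒢 = 𝒢C` -/
  commute : ∀ φ : TestFun, C.comp (𝒢 φ) = (𝒢 φ).comp C
  /-- `𝒢(φ *₀ ψ) C = 𝒢(φ) 𝒢(ψ)` for all `φ, ψ ∈ 𝒟` -/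
  conv : ∀ φ ψ : TestFun, (𝒢 (conv₀ φ ψ)).comp C = (𝒢 φ).comp (𝒢 ψ)
  /-- the operators `𝒢(φ)`, `φ ∈ 𝒟₀`, have no common nonzero kernel vector -/
  kernel : ∀ x : E, (∀ φ ∈ testFunNonneg, 𝒢 φ x = 0) → x = 0

/-- The operator `G(T)`, identified with its graph, for a scalar distribution `T` with compact
support contained in `[0,∞)`: the set of all `(x, y)` with `𝒢(T * φ) x = 𝒢(φ) y` for all
`φ ∈ 𝒟₀`. Here `χ` is the function `T * φ` regarded as a test function. -/
def graphG (𝒢 : TestFun →L[ℂ] (E →L[ℂ] E)) (T : TestFun →L[ℂ] ℂ) : Set (E × E) :=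
  {p | ∀ φ ∈ testFunNonneg, ∀ χ : TestFun, (∀ t : ℝ, χ t = convolve T φ t) → 𝒢 χ p.1 = 𝒢 φ p.2}

/-- `A` is the generator of `𝒢`, that is, `A = G(-δ')`. -/
def IsGenerator (𝒢 : TestFun →L[ℂ] (E →L[ℂ] E)) (A : E →ₗ.[ℂ] E) : Prop :=
  (A.graph : Set (E × E)) = graphG 𝒢 (-distDeriv (dirac 0))

/-- The solution space `Z(A)`: all initial values `x` of mild solutions on `[0,∞)` of
`u' = Au`, `u(0) = x`. -/
def solutionSpace (A : E →ₗ.[ℂ] E) : Set E :=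
  {x | ∃ u : ℝ → E, ContinuousOn u (Set.Ici 0) ∧
    ∀ t : ℝ, 0 ≤ t → (∫ s in (0 : ℝ)..t, u s, u t - x) ∈ A.graph}

/-- The set `D` of all eigenvectors of `A` corresponding to purely imaginary eigenvalues
(zero included). -/
def imaginaryEigenvectors (A : E →ₗ.[ℂ] E) : Set E :=
  {x | x ≠ 0 ∧ ∃ r : ℝ, (x, (Complex.I * (r : ℂ)) • x) ∈ A.graph}

/-! ### Almost periodicity on `[0,∞)` -/

/-- `f : [0,∞) → F` is (Bohr) almost periodic: it is continuous and, for every `ε > 0`, there is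
`l > 0` such that each interval `[a, a + l]` in `[0,∞)` contains an `ε`-period of `f`. -/
def IsAlmostPeriodic {F : Type*} [NormedAddCommGroup F] (f : ℝ → F) : Prop :=
  ContinuousOn f (Set.Ici 0) ∧
    ∀ ε : ℝ, 0 < ε → ∃ l : ℝ, 0 < l ∧ ∀ a : ℝ, 0 ≤ a →
      ∃ τ ∈ Set.Icc a (a + l), ∀ t : ℝ, 0 ≤ t → ‖f (t + τ) - f t‖ ≤ ε

/-- `f : [0,∞) → E` is weakly almost periodic: `x* ∘ f` is almost periodic for all `x* ∈ E*`. -/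
def IsWeaklyAlmostPeriodic (f : ℝ → E) : Prop :=
  ∀ ℓ : E →L[ℂ] ℂ, IsAlmostPeriodic fun t => ℓ (f t)

/-- `𝒢`, generated by `A`, is `V`-almost periodic: `V ⊆ Z(A)` and, for every `x ∈ V`, the orbit
`t ↦ u t = G(δ_t)x`, `t ≥ 0`, is defined and almost periodic. -/
def IsSubspaceAlmostPeriodic (𝒢 : TestFun →L[ℂ] (E →L[ℂ] E)) (A : E →ₗ.[ℂ] E)
    (V : Submodule ℂ E) : Prop :=
  (V : Set E) ⊆ solutionSpace A ∧ ∀ x ∈ V, ∃ u : ℝ → E,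
    (∀ t : ℝ, 0 ≤ t → (x, u t) ∈ graphG 𝒢 (dirac t)) ∧ IsAlmostPeriodic u

/-- `𝒢`, generated by `A`, is `V`-weakly almost periodic: `V ⊆ Z(A)` and, for every `x ∈ V`, the
orbit `t ↦ u t = G(δ_t)x`, `t ≥ 0`, is weakly almost periodic. -/
def IsSubspaceWeaklyAlmostPeriodic (𝒢 : TestFun →L[ℂ] (E →L[ℂ] E)) (A : E →ₗ.[ℂ] E)
    (V : Submodule ℂ E) : Prop :=
  (V : Set E) ⊆ solutionSpace A ∧ ∀ x ∈ V, ∃ u : ℝ → E,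
    (∀ t : ℝ, 0 ≤ t → (x, u t) ∈ graphG 𝒢 (dirac t)) ∧ IsWeaklyAlmostPeriodic u

/-- Every weakly Cauchy sequence of the space converges weakly. -/
def IsWeaklySequentiallyComplete (E : Type*) [NormedAddCommGroup E] [NormedSpace ℂ E] : Prop :=
  ∀ x : ℕ → E, (∀ ℓ : E →L[ℂ] ℂ, CauchySeq fun n => ℓ (x n)) →
    ∃ y : E, ∀ ℓ : E →L[ℂ] ℂ, Filter.Tendsto (fun n => ℓ (x n)) Filter.atTop (nhds (ℓ y))

end CDistSemigroup

/-!
The orbits `u t = G(δ_t)x` with `x ∈ V` are continuous, since the mild solution with initial value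
`x` satisfies the defining relation of `G(δ_t)x` (`mem_graphG_dirac_of_mild_solution`) and that
relation determines `u t`. The function `u` is weakly almost periodic, so in a weakly sequentially
complete space its Fourier–Bohr means `(1/n) ∫₀ⁿ e^{irt} u t dt` converge weakly to some `y`, and
integration by parts shows `A y = -ir y` (`weak_mean_mem_graph`). If a functional `ℓ` vanishes on all
eigenvectors for imaginary eigenvalues, then every Fourier–Bohr coefficient of the scalar almost
periodic function `ℓ ∘ u` is zero; by the uniqueness theorem
(`IsAlmostPeriodic.apply_zero_eq_zero`), `ℓ x = ℓ (u 0) = 0`. Hence `ℓ = 0` on the dense subspace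
`V`, and the span of the eigenvectors is dense by the Hahn–Banach theorem.

Conversely, on that span the orbits are trigonometric polynomials `∑ e^{i r_j t} y_j`, which are
almost periodic because finitely many characters have common almost periods.

The uniqueness theorem is proved for functions on the half-line without compactifications. If all
Fourier–Bohr coefficients of `f` vanish, then `∫₀ᵀ e^{irt} f t dt = o(T)` uniformly in `r`
(`IsAlmostPeriodic.exists_norm_integral_char_mul_le`). Let `F` be `f` cut off to `[0, T]` and let `g`
be its autocorrelation. Its Fourier transform is `|F̂|²`, so Parseval's identity on `[-T, T]`, applied
to `g` and to `F`, bounds `∫ |g|²` by `sup |F̂|² ∫ |F|² = o(T³)`. But if `f 0 ≠ 0`, then `|g|` is at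
least a constant times `T` near every almost period in `[0, T / 2]`, so that `∫ |g|²` is at least a
constant times `T³`.
-/

namespace CDistSemigroup

open MeasureTheory Filter Topology

/-! ### Characters and integrals on the half-line -/

/-- The character `t ↦ e^{irt}` of the real line. -/
noncomputable def char (r t : ℝ) : ℂ := Complex.exp (Complex.I * ((r * t : ℝ) : ℂ))

theorem norm_char (r t : ℝ) : ‖char r t‖ = 1 := by
  rw [char, mul_comm, Complex.norm_exp_ofReal_mul_I]

theorem continuous_char (r : ℝ) : Continuous (char r) := by
  unfold char; fun_prop

theorem char_add (r s t : ℝ) : char r (s + t) = char r s * char r t := by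
  simp only [char]; rw [← Complex.exp_add]; congr 1; push_cast; ring

theorem char_add_left (r s t : ℝ) : char (r + s) t = char r t * char s t := by
  simp only [char]; rw [← Complex.exp_add]; congr 1; push_cast; ring

theorem char_zero_right (r : ℝ) : char r 0 = 1 := by simp [char]

theorem char_zero_left (t : ℝ) : char 0 t = 1 := by simp [char]

theorem norm_char_sub_one_le (r t : ℝ) : ‖char r t - 1‖ ≤ |r * t| := by
  simpa [char] using Real.norm_exp_I_mul_ofReal_sub_one_le (x := r * t)

theorem intervalIntegrable_of_continuousOn_Ici {F : Type*} [NormedAddCommGroup F] {f : ℝ → F}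
    (hf : ContinuousOn f (Set.Ici 0)) {a b : ℝ} (ha : 0 ≤ a) (hb : 0 ≤ b) :
    IntervalIntegrable f volume a b :=
  (hf.mono fun _ ht => (le_min ha hb).trans ht.1).intervalIntegrable

theorem norm_integral_le_of_norm_le_Ici {F : Type*} [NormedAddCommGroup F] [NormedSpace ℝ F]
    {f : ℝ → F} {M : ℝ} (hM : ∀ t, 0 ≤ t → ‖f t‖ ≤ M) {a b : ℝ} (ha : 0 ≤ a) (hb : 0 ≤ b) :
    ‖∫ t in a..b, f t‖ ≤ M * |b - a| :=
  intervalIntegral.norm_integral_le_of_norm_le_const fun t ht =>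
    hM t ((le_min ha hb).trans ht.1.le)

/-! ### Integrals over windows -/

theorem norm_integral_window_sub_le {f : ℝ → ℂ} (hf : ContinuousOn f (Set.Ici 0)) {M : ℝ}
    (hM : ∀ t, 0 ≤ t → ‖f t‖ ≤ M) {a b S : ℝ} (ha : 0 ≤ a) (hb : 0 ≤ b) (hS : 0 ≤ S) :
    ‖(∫ t in a..a + S, f t) - ∫ t in b..b + S, f t‖ ≤ 2 * M * |a - b| := by
  have hi := fun {a b : ℝ} ha hb => intervalIntegrable_of_continuousOn_Ici hf (a := a) (b := b) ha hb
  rw [intervalIntegral.integral_interval_sub_interval_comm (hi ha (by positivity))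
    (hi hb (by positivity)) (hi ha hb)]
  have h1 := norm_integral_le_of_norm_le_Ici hM ha hb
  have h2 := norm_integral_le_of_norm_le_Ici hM (a := a + S) (b := b + S)
    (by positivity) (by positivity)
  rw [abs_sub_comm] at h1
  rw [show b + S - (a + S) = b - a by ring, abs_sub_comm] at h2
  exact (norm_sub_le _ _).trans (by linarith)

/-- If all averages of `h` over windows of a fixed length `S` are at most `η`, then so are, up to an
error `M * S / T`, the averages over `[0, T]`. -/
theorem norm_integral_le_of_window {h : ℝ → ℂ} (hc : ContinuousOn h (Set.Ici 0)) {M η S : ℝ}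
    (hM : ∀ t, 0 ≤ t → ‖h t‖ ≤ M) (hS : 0 < S)
    (hw : ∀ a, 0 ≤ a → ‖∫ t in a..a + S, h t‖ ≤ η * S) {T : ℝ} (hT : 0 ≤ T) :
    ‖∫ t in (0 : ℝ)..T, h t‖ ≤ η * T + M * S := by
  have hM0 : 0 ≤ M := (norm_nonneg _).trans (hM 0 le_rfl)
  have hη : 0 ≤ η := nonneg_of_mul_nonneg_left ((norm_nonneg _).trans (hw 0 le_rfl)) hS
  obtain ⟨n, hn⟩ := exists_nat_ge (T / S)
  rw [div_le_iff₀ hS] at hn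
  induction n generalizing T with
  | zero =>
    obtain rfl : T = 0 := le_antisymm (by simpa using hn) hT
    simpa using by positivity
  | succ n ih =>
    rcases le_total T S with h1 | h1
    · have := norm_integral_le_of_norm_le_Ici hM le_rfl hT
      rw [sub_zero, abs_of_nonneg hT] at this
      nlinarith [mul_nonneg hη hT]
    · have h0 : 0 ≤ T - S := by linarith
      have h2 := ih h0 (by push_cast at hn; linarith)
      have h3 := hw (T - S) h0
      rw [sub_add_cancel] at h3
      rw [← intervalIntegral.integral_add_adjacent_intervals
        (intervalIntegrable_of_continuousOn_Ici hc le_rfl h0)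
        (intervalIntegrable_of_continuousOn_Ici hc h0 hT)]
      exact (norm_add_le _ _).trans (by linarith)

/-! ### Almost periodic functions on the half-line -/

section AlmostPeriodic

variable {F : Type*} [NormedAddCommGroup F]

theorem IsAlmostPeriodic.exists_bound {f : ℝ → F} (hf : IsAlmostPeriodic f) :
    ∃ M, 0 < M ∧ ∀ t, 0 ≤ t → ‖f t‖ ≤ M := by
  obtain ⟨l, hl, hτ⟩ := hf.2 1 one_pos
  obtain ⟨B, hB⟩ := (isCompact_Icc (a := (0 : ℝ)) (b := l)).exists_bound_of_continuousOn
    (hf.1.mono fun t ht => ht.1)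
  have hB0 : 0 ≤ B := (norm_nonneg _).trans (hB 0 ⟨le_rfl, hl.le⟩)
  refine ⟨B + 1, by positivity, fun t ht => ?_⟩
  rcases le_total t l with h | h
  · linarith [hB t ⟨ht, h⟩]
  · obtain ⟨τ, ⟨h1, h2⟩, h3⟩ := hτ (t - l) (by linarith)
    have h4 := h3 (t - τ) (by linarith)
    have h5 := hB (t - τ) ⟨by linarith, by linarith⟩
    rw [sub_add_cancel] at h4
    linarith [norm_le_norm_add_norm_sub' (f t) (f (t - τ))]

theorem IsAlmostPeriodic.uniform_continuity {f : ℝ → F} (hf : IsAlmostPeriodic f) {ε : ℝ}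
    (hε : 0 < ε) :
    ∃ η, 0 < η ∧ ∀ s t, 0 ≤ s → s ≤ t → t ≤ s + η → ‖f t - f s‖ ≤ ε := by
  obtain ⟨l, hl, hτ⟩ := hf.2 (ε / 3) (by positivity)
  have huc : UniformContinuousOn f (Set.Icc 0 (l + 1)) :=
    isCompact_Icc.uniformContinuousOn_of_continuous (hf.1.mono fun t ht => ht.1)
  obtain ⟨δ, hδ, hu⟩ := Metric.uniformContinuousOn_iff.1 huc (ε / 3) (by positivity)
  have key : ∀ s t, 0 ≤ s → s ≤ t → t ≤ s + min 1 (δ / 2) → s ≤ l → ‖f t - f s‖ ≤ ε / 3 := by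
    intro s t hs hst ht hsl
    have h1 := min_le_left 1 (δ / 2)
    have h2 := min_le_right 1 (δ / 2)
    have := hu t ⟨by linarith, by linarith⟩ s ⟨hs, by linarith⟩
      (by rw [Real.dist_eq, abs_of_nonneg (by linarith)]; linarith)
    rw [dist_eq_norm] at this
    exact this.le
  refine ⟨min 1 (δ / 2), by positivity, fun s t hs hst ht => ?_⟩
  rcases le_total s l with h | h
  · linarith [key s t hs hst ht h]
  · obtain ⟨τ, ⟨h1, h2⟩, h3⟩ := hτ (s - l) (by linarith)
    have h4 := h3 (s - τ) (by linarith)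
    have h5 := h3 (t - τ) (by linarith)
    have h6 := key (s - τ) (t - τ) (by linarith) (by linarith) (by linarith) (by linarith)
    rw [sub_add_cancel] at h4 h5
    calc ‖f t - f s‖ = ‖(f t - f (t - τ)) + (f (t - τ) - f (s - τ)) - (f s - f (s - τ))‖ := by
          congr 1; abel
      _ ≤ ‖f t - f (t - τ)‖ + ‖f (t - τ) - f (s - τ)‖ + ‖f s - f (s - τ)‖ :=
          (norm_sub_le _ _).trans (add_le_add_left (norm_add_le _ _) _)
      _ ≤ ε := by linarith

end AlmostPeriodic

/-! ### Fourier–Bohr means -/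

theorem continuousOn_char_mul {f : ℝ → ℂ} (hf : ContinuousOn f (Set.Ici 0)) (r : ℝ) :
    ContinuousOn (fun t => char r t * f t) (Set.Ici 0) :=
  (continuous_char r).continuousOn.mul hf

theorem norm_char_mul (r t : ℝ) (z : ℂ) : ‖char r t * z‖ = ‖z‖ := by
  rw [norm_mul, norm_char, one_mul]

/-- Shifting a window by an almost period `τ` multiplies the integral of `f` against a character by
the value of that character at `τ`, up to a small error. -/
theorem norm_integral_shift_sub_le {f : ℝ → ℂ} (hf : ContinuousOn f (Set.Ici 0)) {ε τ : ℝ}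
    (hτ0 : 0 ≤ τ) (hτ : ∀ t, 0 ≤ t → ‖f (t + τ) - f t‖ ≤ ε) (r : ℝ) {S : ℝ} (hS : 0 ≤ S) :
    ‖(∫ t in τ..τ + S, char r t * f t) - char r τ * ∫ t in (0 : ℝ)..S, char r t * f t‖
      ≤ ε * S := by
  have hg := continuousOn_char_mul hf r
  have h1 : (∫ t in τ..τ + S, char r t * f t) = ∫ t in (0 : ℝ)..S, char r (t + τ) * f (t + τ) := by
    rw [intervalIntegral.integral_comp_add_right (fun t => char r t * f t), zero_add, add_comm]
  have hs : ContinuousOn (fun t => char r (t + τ) * f (t + τ)) (Set.Ici 0) :=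
    hg.comp (by fun_prop) fun t ht => add_nonneg (Set.mem_Ici.1 ht) hτ0
  rw [h1, ← intervalIntegral.integral_const_mul, ← intervalIntegral.integral_sub
    (intervalIntegrable_of_continuousOn_Ici hs le_rfl hS)
    ((intervalIntegrable_of_continuousOn_Ici hg le_rfl hS).const_mul _)]
  refine (norm_integral_le_of_norm_le_Ici (M := ε) (fun t ht => ?_) le_rfl hS).trans
    (by rw [sub_zero, abs_of_nonneg hS])
  have : char r (t + τ) * f (t + τ) - char r τ * (char r t * f t)
      = char r (t + τ) * (f (t + τ) - f t) := by rw [char_add]; ring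
  rw [this, norm_char_mul]
  exact hτ t ht

/-- The integrals of `f` against a character over all windows of length `S` are controlled by the
integral over `[0, S]`. -/
theorem IsAlmostPeriodic.norm_integral_window_le {f : ℝ → ℂ} (hf : IsAlmostPeriodic f) {ε : ℝ}
    (hε : 0 < ε) :
    ∃ K, ∀ r a S, 0 ≤ a → 0 ≤ S →
      ‖∫ t in a..a + S, char r t * f t‖ ≤ ‖∫ t in (0 : ℝ)..S, char r t * f t‖ + ε * S + K := by
  obtain ⟨M, hM, hb⟩ := hf.exists_bound
  obtain ⟨l, hl, hτ⟩ := hf.2 ε hε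
  refine ⟨2 * M * l, fun r a S ha hS => ?_⟩
  obtain ⟨τ, ⟨h1, h2⟩, h3⟩ := hτ a ha
  have hτ0 : 0 ≤ τ := ha.trans h1
  have h4 := norm_integral_shift_sub_le hf.1 hτ0 h3 r hS
  have h5 := norm_integral_window_sub_le (continuousOn_char_mul hf.1 r)
    (fun t ht => (norm_char_mul r t _).trans_le (hb t ht)) ha hτ0 hS
  have h6 : 2 * M * |a - τ| ≤ 2 * M * l := by
    gcongr; rw [abs_sub_comm, abs_of_nonneg (by linarith)]; linarith
  set A := ∫ t in a..a + S, char r t * f t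
  set B := ∫ t in τ..τ + S, char r t * f t
  set D := ∫ t in (0 : ℝ)..S, char r t * f t
  have h7 : ‖A‖ ≤ ‖A - B‖ + ‖B - char r τ * D‖ + ‖char r τ * D‖ := by
    calc ‖A‖ = ‖(A - B) + (B - char r τ * D) + char r τ * D‖ := by congr 1; ring
      _ ≤ _ := norm_add₃_le
  rw [norm_char_mul] at h7
  linarith

/-- An almost periodic function has a mean value. -/
theorem IsAlmostPeriodic.exists_mean {f : ℝ → ℂ} (hf : IsAlmostPeriodic f) :
    ∃ c : ℂ, Tendsto (fun n : ℕ => (n : ℂ)⁻¹ * ∫ t in (0 : ℝ)..n, f t) atTop (𝓝 c) := by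
  obtain ⟨M, hM, hb⟩ := hf.exists_bound
  refine cauchySeq_tendsto_of_complete (Metric.cauchySeq_iff'.2 fun ε hε => ?_)
  obtain ⟨l, hl, hτ⟩ := hf.2 (ε / 8) (by positivity)
  -- a window so long that the shift by an almost period costs at most `ε / 8` on average
  obtain ⟨p, hp⟩ := exists_nat_gt (2 * M * l / (ε / 8))
  have hp0 : (0 : ℝ) < p := lt_of_le_of_lt (by positivity) hp
  rw [div_lt_iff₀ (by positivity)] at hp
  set c : ℂ := (p : ℂ)⁻¹ * ∫ t in (0 : ℝ)..p, f t with hc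
  have hcp : (p : ℂ) * c = ∫ t in (0 : ℝ)..p, f t := by
    rw [hc, mul_inv_cancel_left₀]; exact_mod_cast hp0.ne'
  have hcM : ‖c‖ ≤ M := by
    have h1 := norm_integral_le_of_norm_le_Ici hb le_rfl hp0.le
    rw [← hcp, norm_mul, sub_zero, abs_of_pos hp0, Complex.norm_natCast, mul_comm] at h1
    exact le_of_mul_le_mul_right h1 hp0
  have hcont : ContinuousOn (fun t => f t - c) (Set.Ici 0) := hf.1.sub continuousOn_const
  have hwin : ∀ a, 0 ≤ a → ‖∫ t in a..a + p, (f t - c)‖ ≤ (ε / 4) * p := by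
    intro a ha
    obtain ⟨τ, ⟨h1, h2⟩, h3⟩ := hτ a ha
    have hτ0 : 0 ≤ τ := ha.trans h1
    have h4 := norm_integral_shift_sub_le hf.1 hτ0 h3 0 hp0.le
    simp only [char_zero_left, one_mul] at h4
    have h5 := norm_integral_window_sub_le hf.1 hb ha hτ0 hp0.le
    have h6 : 2 * M * |a - τ| ≤ 2 * M * l := by
      gcongr; rw [abs_sub_comm, abs_of_nonneg (by linarith)]; linarith
    rw [intervalIntegral.integral_sub
      (intervalIntegrable_of_continuousOn_Ici hf.1 ha (by positivity)) (by simp),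
      intervalIntegral.integral_const, add_sub_cancel_left, Complex.real_smul,
      Complex.ofReal_natCast, hcp]
    have h7 := norm_sub_le_norm_sub_add_norm_sub (∫ t in a..a + p, f t)
      (∫ t in τ..τ + p, f t) (∫ t in (0 : ℝ)..p, f t)
    linarith
  have hkey : ∀ n : ℕ, 0 < n →
      ‖(n : ℂ)⁻¹ * (∫ t in (0 : ℝ)..n, f t) - c‖ ≤ ε / 4 + 2 * M * p / n := by
    intro n hn
    have hn' : (0 : ℝ) < n := by exact_mod_cast hn
    have h1 := norm_integral_le_of_window hcont (M := 2 * M)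
      (fun t ht => (norm_sub_le _ _).trans (by linarith [hb t ht])) hp0 hwin hn'.le
    rw [intervalIntegral.integral_sub
      (intervalIntegrable_of_continuousOn_Ici hf.1 le_rfl hn'.le) (by simp),
      intervalIntegral.integral_const, sub_zero, Complex.real_smul, Complex.ofReal_natCast] at h1
    have h2 : (n : ℂ)⁻¹ * (∫ t in (0 : ℝ)..n, f t) - c
        = (n : ℂ)⁻¹ * ((∫ t in (0 : ℝ)..n, f t) - n * c) := by
      have : (n : ℂ) ≠ 0 := by exact_mod_cast hn.ne'
      field_simp
    rw [h2, norm_mul, norm_inv, Complex.norm_natCast, inv_mul_le_iff₀ hn']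
    calc _ ≤ _ := h1
      _ = _ := by field_simp
  obtain ⟨N, hN⟩ := exists_nat_gt (2 * M * p / (ε / 8))
  have hN0 : (0 : ℝ) < N := lt_of_le_of_lt (by positivity) hN
  have hsmall : ∀ n : ℕ, N ≤ n →
      ‖(n : ℂ)⁻¹ * (∫ t in (0 : ℝ)..n, f t) - c‖ ≤ ε / 4 + ε / 8 := by
    intro n hn
    have hn' : (N : ℝ) ≤ n := by exact_mod_cast hn
    have hn0 : (0 : ℝ) < n := hN0.trans_le hn'
    refine (hkey n (by exact_mod_cast hn0)).trans (add_le_add_right ?_ _)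
    rw [div_lt_iff₀ (by positivity)] at hN
    rw [div_le_iff₀ hn0]
    nlinarith
  refine ⟨N, fun n hn => ?_⟩
  rw [dist_eq_norm]
  have := norm_sub_le_norm_sub_add_norm_sub ((n : ℂ)⁻¹ * (∫ t in (0 : ℝ)..n, f t)) c
    ((N : ℂ)⁻¹ * (∫ t in (0 : ℝ)..N, f t))
  rw [norm_sub_rev c] at this
  linarith [hsmall n hn, hsmall N le_rfl]

/-- The Fourier–Bohr coefficients of an almost periodic function exist. Either the averages against
the character `χ` tend to `0`, or they stay away from `0` along a subsequence; in the latter case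
`χ τ` is close to `1` for every almost period `τ` of `f`, so that `χ * f` is almost periodic. -/
theorem IsAlmostPeriodic.exists_mean_char_mul {f : ℝ → ℂ} (hf : IsAlmostPeriodic f) (r : ℝ) :
    ∃ c : ℂ, Tendsto (fun n : ℕ => (n : ℂ)⁻¹ * ∫ t in (0 : ℝ)..n, char r t * f t)
      atTop (𝓝 c) := by
  by_cases h0 : Tendsto (fun n : ℕ => (n : ℂ)⁻¹ * ∫ t in (0 : ℝ)..n, char r t * f t) atTop (𝓝 0)
  · exact ⟨0, h0⟩
  obtain ⟨M, hM, hb⟩ := hf.exists_bound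
  have hbg : ∀ t, 0 ≤ t → ‖char r t * f t‖ ≤ M := fun t ht =>
    (norm_char_mul r t _).trans_le (hb t ht)
  rw [Metric.tendsto_atTop] at h0
  push Not at h0
  obtain ⟨κ, hκ, hfreq⟩ := h0
  have hclose : ∀ ε τ, 0 < ε → 0 ≤ τ → (∀ t, 0 ≤ t → ‖f (t + τ) - f t‖ ≤ ε) →
      ‖1 - char r τ‖ * κ ≤ 2 * ε := by
    intro ε τ hε hτ0 hτ
    obtain ⟨N, hN⟩ := exists_nat_gt (2 * M * τ / ε)
    obtain ⟨n, hn, hn2⟩ := hfreq (N + 1)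
    have hn0 : (0 : ℝ) < n := by exact_mod_cast (Nat.succ_pos N).trans_le hn
    have hnN : (N : ℝ) ≤ n := by exact_mod_cast (Nat.le_succ N).trans hn
    rw [div_lt_iff₀ hε] at hN
    rw [dist_zero_right, norm_mul, norm_inv, Complex.norm_natCast, le_inv_mul_iff₀ hn0] at hn2
    have h1 := norm_integral_shift_sub_le hf.1 hτ0 hτ r hn0.le
    have h2 := norm_integral_window_sub_le (continuousOn_char_mul hf.1 r) hbg le_rfl hτ0 hn0.le
    rw [zero_add, zero_sub, abs_neg, abs_of_nonneg hτ0] at h2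
    set A := ∫ t in (0 : ℝ)..n, char r t * f t
    set B := ∫ t in τ..τ + n, char r t * f t
    have h3 : ‖1 - char r τ‖ * ‖A‖ ≤ 2 * M * τ + ε * n := by
      rw [← norm_mul, show (1 - char r τ) * A = (A - B) + (B - char r τ * A) by ring]
      exact (norm_add_le _ _).trans (add_le_add h2 h1)
    have h4 : ‖1 - char r τ‖ * (n * κ) ≤ ‖1 - char r τ‖ * ‖A‖ := by gcongr
    have h5 : (‖1 - char r τ‖ * κ) * n ≤ (2 * ε) * n := by nlinarith
    exact le_of_mul_le_mul_right h5 hn0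
  refine IsAlmostPeriodic.exists_mean ⟨continuousOn_char_mul hf.1 r, fun ε hε => ?_⟩
  set ε' := min (ε / 2) (κ * ε / (4 * M)) with hε'
  have hε'0 : 0 < ε' := by positivity
  obtain ⟨l, hl, hτ⟩ := hf.2 ε' hε'0
  refine ⟨l, hl, fun a ha => ?_⟩
  obtain ⟨τ, hτl, hτ1⟩ := hτ a ha
  refine ⟨τ, hτl, fun t ht => ?_⟩
  have h1 := hclose ε' τ hε'0 (ha.trans hτl.1) hτ1
  have h2 : char r (t + τ) * f (t + τ) - char r t * f t
      = char r (t + τ) * (f (t + τ) - f t) - char r t * ((1 - char r τ) * f t) := by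
    rw [char_add]; ring
  rw [h2]
  refine (norm_sub_le _ _).trans ?_
  rw [norm_char_mul, norm_char_mul, norm_mul]
  have h3 : ‖1 - char r τ‖ * κ ≤ (ε / (2 * M)) * κ := by
    have : ε' ≤ κ * ε / (4 * M) := min_le_right _ _
    calc _ ≤ 2 * ε' := h1
      _ ≤ 2 * (κ * ε / (4 * M)) := by gcongr
      _ = _ := by field_simp; ring
  have h4 : ‖1 - char r τ‖ ≤ ε / (2 * M) := le_of_mul_le_mul_right h3 hκ
  have h5 : ‖1 - char r τ‖ * ‖f t‖ ≤ ε / (2 * M) * M := by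
    gcongr; exact hb t ht
  have h6 : ε / (2 * M) * M = ε / 2 := by field_simp
  have h7 : ε' ≤ ε / 2 := min_le_left _ _
  linarith [hτ1 t ht]

/-! ### Uniform decay of the Fourier integrals -/

theorem integral_char_period {r S : ℝ} (hr : r ≠ 0) (hS : |r| * S = 2 * Real.pi) (a : ℝ) :
    ∫ t in a..a + S, char r t = 0 := by
  have hc : Complex.I * (r : ℂ) ≠ 0 := mul_ne_zero Complex.I_ne_zero (by exact_mod_cast hr)
  have h1 : ∀ t : ℝ, char r t = Complex.exp (Complex.I * (r : ℂ) * t) := fun t => by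
    rw [char]; push_cast; ring_nf
  simp_rw [h1]
  rw [integral_exp_mul_complex hc, div_eq_zero_iff]
  left
  have h2 : Complex.exp (Complex.I * (r : ℂ) * (S : ℂ)) = 1 := by
    rcases abs_choice r with h | h
    · rw [h] at hS
      rw [mul_assoc, ← Complex.ofReal_mul, hS, Complex.exp_eq_one_iff]
      exact ⟨1, by push_cast; ring⟩
    · rw [h] at hS
      rw [mul_assoc, ← Complex.ofReal_mul, show r * S = -(2 * Real.pi) by linarith,
        Complex.exp_eq_one_iff]
      exact ⟨-1, by push_cast; ring⟩
  rw [Complex.ofReal_add, mul_add, Complex.exp_add, h2, mul_one, sub_self]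

/-- For large frequencies the Fourier integrals of an almost periodic function are small by uniform
continuity: the function is nearly constant on each period of the character. -/
theorem IsAlmostPeriodic.exists_norm_integral_char_mul_le_of_large {f : ℝ → ℂ}
    (hf : IsAlmostPeriodic f) {κ : ℝ} (hκ : 0 < κ) :
    ∃ R T₀ : ℝ, ∀ r T, R ≤ |r| → T₀ ≤ T → 0 ≤ T →
      ‖∫ t in (0 : ℝ)..T, char r t * f t‖ ≤ κ * T := by
  obtain ⟨M, hM, hb⟩ := hf.exists_bound
  obtain ⟨η, hη, huc⟩ := hf.uniform_continuity (ε := κ / 2) (by positivity)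
  refine ⟨2 * Real.pi / η, 2 * M * η / κ, fun r T hr hT hT0 => ?_⟩
  have hπ := Real.pi_pos
  have hr0 : 0 < |r| := lt_of_lt_of_le (by positivity) hr
  set S := 2 * Real.pi / |r| with hS
  have hS0 : 0 < S := by positivity
  have hSη : S ≤ η := by
    rw [hS, div_le_iff₀ hr0]
    rw [div_le_iff₀ hη] at hr
    linarith
  have hw : ∀ a, 0 ≤ a → ‖∫ t in a..a + S, char r t * f t‖ ≤ κ / 2 * S := by
    intro a ha
    have hi := intervalIntegrable_of_continuousOn_Ici (continuousOn_char_mul hf.1 r) ha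
      (b := a + S) (by positivity)
    have hi2 : IntervalIntegrable (fun t => char r t * f a) volume a (a + S) :=
      ((continuous_char r).mul continuous_const).intervalIntegrable _ _
    have h1 : (∫ t in a..a + S, char r t * f t)
        = ∫ t in a..a + S, (char r t * f t - char r t * f a) := by
      rw [intervalIntegral.integral_sub hi hi2, intervalIntegral.integral_mul_const,
        integral_char_period (abs_pos.1 hr0) (by rw [hS]; field_simp), zero_mul, sub_zero]
    rw [h1]
    refine (intervalIntegral.norm_integral_le_of_norm_le_const (C := κ / 2) fun t ht => ?_).trans ?_
    · rw [Set.uIoc_of_le (by linarith)] at ht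
      rw [← mul_sub, norm_char_mul]
      exact huc a t ha ht.1.le (by linarith [ht.2])
    · rw [add_sub_cancel_left, abs_of_pos hS0]
  have h2 := norm_integral_le_of_window (continuousOn_char_mul hf.1 r)
    (fun t ht => (norm_char_mul r t _).trans_le (hb t ht)) hS0 hw hT0
  rw [div_le_iff₀ hκ] at hT
  have : M * S ≤ M * η := by gcongr
  linarith

/-- If a Fourier–Bohr coefficient of an almost periodic function vanishes, then the Fourier
integrals over `[0, T]` are `o(T)` uniformly in a neighbourhood of that frequency. -/
theorem IsAlmostPeriodic.exists_norm_integral_char_mul_le_nhds {f : ℝ → ℂ}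
    (hf : IsAlmostPeriodic f) {r₀ : ℝ}
    (h0 : Tendsto (fun n : ℕ => (n : ℂ)⁻¹ * ∫ t in (0 : ℝ)..n, char r₀ t * f t) atTop (𝓝 0))
    {κ : ℝ} (hκ : 0 < κ) :
    ∃ δ > 0, ∃ T₀ : ℝ, ∀ r T, |r - r₀| < δ → T₀ ≤ T → 0 ≤ T →
      ‖∫ t in (0 : ℝ)..T, char r t * f t‖ ≤ κ * T := by
  obtain ⟨M, hM, hb⟩ := hf.exists_bound
  obtain ⟨K, hK⟩ := hf.norm_integral_window_le (ε := κ / 4) (by positivity)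
  obtain ⟨N, hN⟩ := Metric.tendsto_atTop.1 h0 (κ / 8) (by positivity)
  obtain ⟨N', hN'⟩ := exists_nat_gt (K / (κ / 8))
  set n := max (max N N') 1
  have hn0 : (0 : ℝ) < n := by exact_mod_cast Nat.lt_of_lt_of_le one_pos (le_max_right _ _)
  have hnN' : (N' : ℝ) ≤ n := by exact_mod_cast (le_max_right _ _).trans (le_max_left _ _)
  have h1 := hN n ((le_max_left _ _).trans (le_max_left _ _))
  rw [dist_zero_right, norm_mul, norm_inv, Complex.norm_natCast, inv_mul_lt_iff₀ hn0] at h1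
  rw [div_lt_iff₀ (by positivity)] at hN'
  have hKn : K ≤ κ / 8 * n := by nlinarith
  have hw0 : ∀ a, 0 ≤ a → ‖∫ t in a..a + n, char r₀ t * f t‖ ≤ κ / 2 * n := fun a ha => by
    linarith [hK r₀ a n ha hn0.le]
  refine ⟨κ / (4 * M * n), by positivity, 4 * M * n / κ, fun r T hr hT hT0 => ?_⟩
  have hw : ∀ a, 0 ≤ a → ‖∫ t in a..a + n, char r t * f t‖ ≤ (3 * κ / 4) * n := by
    intro a ha
    have han : 0 ≤ a + n := by positivity
    have hi := intervalIntegrable_of_continuousOn_Ici (continuousOn_char_mul hf.1 r) ha han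
    have hi0 := (intervalIntegrable_of_continuousOn_Ici (continuousOn_char_mul hf.1 r₀) ha
      han).const_mul (char (r - r₀) a)
    have h2 : ‖(∫ t in a..a + n, char r t * f t)
        - char (r - r₀) a * ∫ t in a..a + n, char r₀ t * f t‖ ≤ (κ / 4) * n := by
      rw [← intervalIntegral.integral_const_mul, ← intervalIntegral.integral_sub hi hi0]
      refine (intervalIntegral.norm_integral_le_of_norm_le_const (C := κ / 4)
        fun t ht => ?_).trans ?_
      · rw [Set.uIoc_of_le (by linarith)] at ht
        have e1 : char r t = char r₀ t * (char (r - r₀) a * char (r - r₀) (t - a)) := by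
          rw [← char_add, add_sub_cancel, ← char_add_left, add_sub_cancel]
        have e2 : char r t * f t - char (r - r₀) a * (char r₀ t * f t)
            = char r₀ t * (char (r - r₀) a * ((char (r - r₀) (t - a) - 1) * f t)) := by
          rw [e1]; ring
        rw [e2, norm_char_mul, norm_char_mul, norm_mul]
        have h3 : ‖char (r - r₀) (t - a) - 1‖ ≤ κ / (4 * M * n) * n := by
          refine (norm_char_sub_one_le _ _).trans ?_
          rw [abs_mul, abs_of_nonneg (a := t - a) (by linarith [ht.1])]
          exact mul_le_mul hr.le (by linarith [ht.2]) (by linarith [ht.1]) (by positivity)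
        calc _ ≤ κ / (4 * M * n) * n * M := by
              gcongr; exact hb t (ha.trans ht.1.le)
          _ = κ / 4 := by field_simp
      · rw [add_sub_cancel_left, abs_of_pos hn0]
    have h4 := norm_le_norm_add_norm_sub' (∫ t in a..a + n, char r t * f t)
      (char (r - r₀) a * ∫ t in a..a + n, char r₀ t * f t)
    rw [norm_char_mul] at h4
    linarith [hw0 a ha]
  have h5 := norm_integral_le_of_window (continuousOn_char_mul hf.1 r)
    (fun t ht => (norm_char_mul r t _).trans_le (hb t ht)) hn0 hw hT0
  rw [div_le_iff₀ hκ] at hT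
  linarith

/-- If all Fourier–Bohr coefficients of an almost periodic function vanish, then its Fourier
integrals over `[0, T]` are `o(T)`, uniformly in the frequency. -/
theorem IsAlmostPeriodic.exists_norm_integral_char_mul_le {f : ℝ → ℂ} (hf : IsAlmostPeriodic f)
    (h0 : ∀ r, Tendsto (fun n : ℕ => (n : ℂ)⁻¹ * ∫ t in (0 : ℝ)..n, char r t * f t)
      atTop (𝓝 0)) {κ : ℝ} (hκ : 0 < κ) :
    ∃ T₀ : ℝ, ∀ r T, T₀ ≤ T → 0 ≤ T → ‖∫ t in (0 : ℝ)..T, char r t * f t‖ ≤ κ * T := by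
  obtain ⟨R, T₁, h1⟩ := hf.exists_norm_integral_char_mul_le_of_large hκ
  obtain ⟨T₂, h2⟩ : ∃ T₂ : ℝ, ∀ r ∈ Set.Icc (-R) R, ∀ T, T₂ ≤ T → 0 ≤ T →
      ‖∫ t in (0 : ℝ)..T, char r t * f t‖ ≤ κ * T := by
    refine isCompact_Icc.induction_on
      (p := fun s => ∃ T₂ : ℝ, ∀ r ∈ s, ∀ T, T₂ ≤ T → 0 ≤ T →
        ‖∫ t in (0 : ℝ)..T, char r t * f t‖ ≤ κ * T) ⟨0, by simp⟩ ?_ ?_ ?_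
    · rintro s t hst ⟨T₂, h⟩
      exact ⟨T₂, fun r hr => h r (hst hr)⟩
    · rintro s t ⟨T₂, h⟩ ⟨T₃, h'⟩
      refine ⟨max T₂ T₃, fun r hr T hT => ?_⟩
      rcases hr with hr | hr
      · exact h r hr T ((le_max_left _ _).trans hT)
      · exact h' r hr T ((le_max_right _ _).trans hT)
    · intro r₀ _
      obtain ⟨δ, hδ, T₂, h⟩ := hf.exists_norm_integral_char_mul_le_nhds (h0 r₀) hκ
      exact ⟨Metric.ball r₀ δ, mem_nhdsWithin_of_mem_nhds (Metric.ball_mem_nhds _ hδ), T₂,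
        fun r hr T => h r T hr⟩
  refine ⟨max T₁ T₂, fun r T hT hT0 => ?_⟩
  rcases le_total R |r| with h | h
  · exact h1 r T h ((le_max_left _ _).trans hT) hT0
  · exact h2 r (abs_le.1 h) T ((le_max_right _ _).trans hT) hT0

/-! ### The autocorrelation function -/

/-- A function that is at least `c` on an interval of length `η` in each window of length `l + η`
has a large integral. -/
theorem mul_le_integral_of_relatively_dense {h : ℝ → ℝ} {T l η c : ℝ} (hl : 0 < l) (hη : 0 < η)
    (hc : 0 ≤ c) (hT : 0 ≤ T) (h0 : ∀ t, 0 ≤ h t) (hi : IntervalIntegrable h volume 0 T)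
    (hd : ∀ a, 0 ≤ a → a + (l + η) ≤ T →
      ∃ τ ∈ Set.Icc a (a + l), ∀ θ ∈ Set.Icc 0 η, c ≤ h (τ + θ)) :
    c * η * (T / (l + η) - 1) ≤ ∫ t in (0 : ℝ)..T, h t := by
  have hlη : 0 < l + η := by positivity
  have hsub : ∀ {a b : ℝ}, 0 ≤ a → a ≤ T → 0 ≤ b → b ≤ T → IntervalIntegrable h volume a b := by
    intro a b ha ha' hb hb'
    refine hi.mono_set (Set.uIcc_subset_uIcc ?_ ?_) <;> rw [Set.uIcc_of_le hT]
    exacts [⟨ha, ha'⟩, ⟨hb, hb'⟩]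
  have key : ∀ n : ℕ, n * (l + η) ≤ T → n * (c * η) ≤ ∫ t in (0 : ℝ)..(n * (l + η)), h t := by
    intro n
    induction n with
    | zero => simp
    | succ n ih =>
      intro hn
      have e : ((n + 1 : ℕ) : ℝ) * (l + η) = n * (l + η) + (l + η) := by push_cast; ring
      rw [e] at hn ⊢
      have hb0 : (0 : ℝ) ≤ n * (l + η) := by positivity
      set b := (n : ℝ) * (l + η)
      have h1 := ih (by linarith)
      obtain ⟨τ, ⟨h2, h3⟩, h4⟩ := hd b hb0 hn
      have h5 : (∫ t in τ..τ + η, h t) ≤ ∫ t in b..b + (l + η), h t :=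
        intervalIntegral.integral_mono_interval h2 (by linarith) (by linarith)
          (Eventually.of_forall h0) (hsub hb0 (by linarith) (by linarith) (by linarith))
      have h6 : (∫ _ in τ..τ + η, c) ≤ ∫ t in τ..τ + η, h t := by
        refine intervalIntegral.integral_mono_on (by linarith) (by simp)
          (hsub (by linarith) (by linarith) (by linarith) (by linarith)) fun t ht => ?_
        simpa using h4 (t - τ) ⟨by linarith [ht.1], by linarith [ht.2]⟩
      rw [intervalIntegral.integral_const, add_sub_cancel_left, smul_eq_mul] at h6
      rw [← intervalIntegral.integral_add_adjacent_intervals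
        (hsub le_rfl hT hb0 (by linarith)) (hsub hb0 (by linarith) (by linarith) hn)]
      push_cast
      linarith
  have hfl := Nat.floor_le (a := T / (l + η)) (by positivity)
  have hfl2 := Nat.lt_floor_add_one (T / (l + η))
  set n := ⌊T / (l + η)⌋₊
  rw [le_div_iff₀ hlη] at hfl
  have h1 := key n hfl
  have h2 : (∫ t in (0 : ℝ)..(n * (l + η)), h t) ≤ ∫ t in (0 : ℝ)..T, h t :=
    intervalIntegral.integral_mono_interval le_rfl (by positivity) hfl
      (Eventually.of_forall h0) hi
  have h3 : c * η * (T / (l + η) - 1) ≤ c * η * n := by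
    gcongr; linarith
  linarith

open scoped FourierTransform ComplexConjugate Convolution

/-- The Fourier coefficients of a function supported in an interval are values of its Fourier
transform. -/
theorem fourierCoeffOn_eq_fourier {H : ℝ → ℂ} {T : ℝ} (hT : 0 < T)
    (hs : ∀ t, t ∉ Set.Ioc (-T) T → H t = 0) (n : ℤ) :
    fourierCoeffOn (neg_lt_self hT) H n
      = (1 / (2 * T)) • 𝓕 H (n / (2 * T)) := by
  rw [fourierCoeffOn_eq_integral, Real.fourier_real_eq_integral_exp_smul,
    intervalIntegral.integral_of_le (by linarith)]
  rw [setIntegral_eq_integral_of_forall_compl_eq_zero (fun t ht => by rw [hs t ht, smul_zero])]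
  rw [show T - -T = 2 * T by ring]
  congr 1
  refine integral_congr_ae (Eventually.of_forall fun x => ?_)
  simp only
  rw [fourier_coe_apply]
  congr 2
  push_cast
  ring

theorem norm_fourier_conj_neg (F : ℝ → ℂ) (w : ℝ) :
    ‖𝓕 (fun s => conj (F (-s))) w‖ = ‖𝓕 F w‖ := by
  rw [Real.fourier_real_eq_integral_exp_smul, Real.fourier_real_eq_integral_exp_smul,
    ← integral_neg_eq_self, ← RCLike.norm_conj (∫ v : ℝ, _), ← integral_conj]
  congr 2
  funext v
  simp only [smul_eq_mul, map_mul, neg_neg, Complex.conj_conj, ← Complex.exp_conj,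
    Complex.conj_ofReal, Complex.conj_I]
  congr 2
  push_cast
  ring

/-- The autocorrelation `t ↦ ∫ F(t + s) conj(F(s)) ds`. -/
noncomputable def autocorrelation (F : ℝ → ℂ) (t : ℝ) : ℂ := ∫ s, F (t + s) * conj (F s)

theorem autocorrelation_eq_convolution (F : ℝ → ℂ) :
    autocorrelation F = (fun s => conj (F (-s))) ⋆[ContinuousLinearMap.mul ℂ ℂ, volume] F := by
  funext t
  rw [autocorrelation, convolution_def, ← integral_neg_eq_self]
  refine integral_congr_ae (Eventually.of_forall fun s => ?_)
  simp [mul_comm, sub_eq_add_neg]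

/-- The `L²` norm of the autocorrelation is bounded by the supremum of the Fourier transform times
the `L²` norm: on the Fourier side this is `∑ |a|⁴ ≤ sup |a|² * ∑ |a|²`. -/
theorem integral_norm_sq_autocorrelation_le {F : ℝ → ℂ} {T M κ : ℝ} (hT : 0 < T)
    (hF : Integrable F) (hM : ∀ t, ‖F t‖ ≤ M) (hs : ∀ t, t ∉ Set.Ioc 0 T → F t = 0)
    (hκ : ∀ w, ‖𝓕 F w‖ ≤ κ) :
    IntervalIntegrable (fun t => ‖autocorrelation F t‖ ^ 2) volume (-T) T ∧
    ∫ t in (-T)..T, ‖autocorrelation F t‖ ^ 2 ≤ κ ^ 2 * ∫ t in (-T)..T, ‖F t‖ ^ 2 := by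
  have hT2 : -T ≤ T := by linarith
  have hF' : Integrable (fun s => conj (F (-s))) :=
    (Complex.conjLIE.integrable_comp_iff (φ := fun s => F (-s))).2 hF.comp_neg
  have hint : Integrable (autocorrelation F) := by
    rw [autocorrelation_eq_convolution]
    exact hF'.integrable_convolution _ hF
  have hGM : ∀ t, ‖autocorrelation F t‖ ≤ M * ∫ s, ‖F s‖ := by
    intro t
    rw [← integral_const_mul]
    refine norm_integral_le_of_norm_le (hF.norm.const_mul M) (Eventually.of_forall fun s => ?_)
    rw [norm_mul, RCLike.norm_conj]
    gcongr
    exact hM _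
  have hGs : ∀ t, t ∉ Set.Ioc (-T) T → autocorrelation F t = 0 := by
    intro t ht
    rw [autocorrelation]
    refine (integral_congr_ae (Eventually.of_forall fun s => ?_)).trans (integral_zero _ _)
    by_contra h
    obtain ⟨h1, h2⟩ := mul_ne_zero_iff.1 h
    have h3 : t + s ∈ Set.Ioc 0 T := by by_contra h; exact h1 (hs _ h)
    have h4 : s ∈ Set.Ioc 0 T := by by_contra h; exact h2 (by rw [hs _ h, map_zero])
    exact ht ⟨by linarith [h3.1, h4.2], by linarith [h3.2, h4.1]⟩
  have hGL : MemLp (autocorrelation F) 2 (volume.restrict (Set.Ioc (-T) T)) :=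
    MemLp.of_bound hint.aestronglyMeasurable.restrict _ (Eventually.of_forall hGM)
  have hFL : MemLp F 2 (volume.restrict (Set.Ioc (-T) T)) :=
    MemLp.of_bound hF.aestronglyMeasurable.restrict _ (Eventually.of_forall hM)
  have hFs : ∀ t, t ∉ Set.Ioc (-T) T → F t = 0 := fun t ht => hs t fun h =>
    ht ⟨by linarith [h.1], h.2⟩
  refine ⟨?_, ?_⟩
  · rw [intervalIntegrable_iff_integrableOn_Ioc_of_le hT2]
    exact hGL.integrable_norm_pow two_ne_zero
  have hG := hasSum_sq_fourierCoeffOn (neg_lt_self hT) hGL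
  have hFh := (hasSum_sq_fourierCoeffOn (neg_lt_self hT) hFL).mul_left (κ ^ 2)
  have hle := hasSum_le (fun n => ?_) hG hFh
  · rw [smul_eq_mul, smul_eq_mul, mul_left_comm] at hle
    exact le_of_mul_le_mul_left hle (by rw [inv_pos]; linarith)
  · rw [fourierCoeffOn_eq_fourier hT hGs, fourierCoeffOn_eq_fourier hT hFs,
      autocorrelation_eq_convolution, Real.fourier_mul_convolution_eq hF' hF, norm_smul, norm_smul,
      norm_mul, norm_fourier_conj_neg]
    have h1 := hκ (n / (2 * T))
    set a := ‖𝓕 F (n / (2 * T))‖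
    have ha : 0 ≤ a := norm_nonneg _
    have h2 : (‖1 / (2 * T)‖ * (a * a)) ^ 2 = (‖1 / (2 * T)‖ * a) ^ 2 * a ^ 2 := by ring
    rw [h2, mul_comm]
    gcongr

/-! ### The uniqueness theorem -/

/-- The mean square of an almost periodic function that does not vanish at `0` is positive. -/
theorem IsAlmostPeriodic.exists_mul_le_integral_norm_sq {f : ℝ → ℂ} (hf : IsAlmostPeriodic f)
    (h0 : f 0 ≠ 0) :
    ∃ m T₀ : ℝ, 0 < m ∧ ∀ T, T₀ ≤ T → 0 ≤ T → m * T ≤ ∫ t in (0 : ℝ)..T, ‖f t‖ ^ 2 := by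
  have ha : 0 < ‖f 0‖ := norm_pos_iff.2 h0
  set a := ‖f 0‖
  obtain ⟨l, hl, hτ⟩ := hf.2 (a / 4) (by positivity)
  obtain ⟨η, hη, huc⟩ := hf.uniform_continuity (ε := a / 4) (by positivity)
  refine ⟨(a / 2) ^ 2 * η * (1 / (2 * (l + η))), 2 * (l + η), by positivity, fun T hT hT0 => ?_⟩
  have h1 := mul_le_integral_of_relatively_dense (h := fun t => ‖f t‖ ^ 2) (c := (a / 2) ^ 2) hl hη
    (by positivity) hT0 (fun t => by positivity)
    (intervalIntegrable_of_continuousOn_Ici (hf.1.norm.pow 2) le_rfl hT0) ?_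
  · refine le_trans ?_ h1
    rw [mul_assoc]
    gcongr
    have : 2 ≤ T / (l + η) := by rw [le_div_iff₀ (by positivity)]; exact hT
    have e : 1 / (2 * (l + η)) * T = (T / (l + η)) / 2 := by field_simp
    rw [e]; linarith
  · intro b hb _
    obtain ⟨τ, hτ1, hτ2⟩ := hτ b hb
    refine ⟨τ, hτ1, fun θ hθ => ?_⟩
    have h2 := hτ2 0 le_rfl
    rw [zero_add] at h2
    have h3 := huc τ (τ + θ) (hb.trans hτ1.1) (by linarith [hθ.1]) (by linarith [hθ.2])
    have h4 := norm_sub_norm_le (f 0) (f τ)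
    have h5 := norm_sub_norm_le (f τ) (f (τ + θ))
    rw [norm_sub_rev] at h4 h5
    have h6 : a / 2 ≤ ‖f (τ + θ)‖ := by linarith
    gcongr

/-- **Uniqueness theorem** for almost periodic functions: a function all of whose Fourier–Bohr
coefficients vanish is zero at the origin. -/
theorem IsAlmostPeriodic.apply_zero_eq_zero {f : ℝ → ℂ} (hf : IsAlmostPeriodic f)
    (hmean : ∀ r, Tendsto (fun n : ℕ => (n : ℂ)⁻¹ * ∫ t in (0 : ℝ)..n, char r t * f t)
      atTop (𝓝 0)) : f 0 = 0 := by
  by_contra h0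
  obtain ⟨M, hM, hb⟩ := hf.exists_bound
  obtain ⟨m, T₁, hm, hms⟩ := hf.exists_mul_le_integral_norm_sq h0
  obtain ⟨l, hl, hτ⟩ := hf.2 (m / (8 * M)) (by positivity)
  obtain ⟨η, hη, huc⟩ := hf.uniform_continuity (ε := m / (8 * M)) (by positivity)
  -- the lower bound `(m T / 4) ^ 2 * η * T / (4 (l + η))` for the square integral of the
  -- autocorrelation on `[0, T / 2]` has to exceed the upper bound `(κ T) ^ 2 * M ^ 2 * T`
  set q := (m / 4) ^ 2 * η * (1 / (4 * (l + η))) with hq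
  have hq0 : 0 < q := by positivity
  set κ := Real.sqrt (q / (2 * M ^ 2))
  have hκ0 : 0 < κ := Real.sqrt_pos.2 (by positivity)
  have hκ2 : κ ^ 2 = q / (2 * M ^ 2) := Real.sq_sqrt (by positivity)
  obtain ⟨T₂, hT₂⟩ := hf.exists_norm_integral_char_mul_le hmean hκ0
  obtain ⟨T, hTlarge⟩ : ∃ T : ℝ, max (max (2 * T₁) T₂) (max (4 * (l + η)) 1) ≤ T := ⟨_, le_rfl⟩
  have hTa : 2 * T₁ ≤ T := (le_max_left _ _).trans ((le_max_left _ _).trans hTlarge)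
  have hTb : T₂ ≤ T := (le_max_right _ _).trans ((le_max_left _ _).trans hTlarge)
  have hTc : 4 * (l + η) ≤ T := (le_max_left _ _).trans ((le_max_right _ _).trans hTlarge)
  have hT : 0 < T := one_pos.trans_le ((le_max_right _ _).trans ((le_max_right _ _).trans hTlarge))
  set F : ℝ → ℂ := (Set.Ioc 0 T).indicator f
  have hFs : ∀ t, t ∉ Set.Ioc 0 T → F t = 0 := fun t ht => Set.indicator_of_notMem ht f
  have hFf : ∀ t, t ∈ Set.Ioc 0 T → F t = f t := fun t ht => Set.indicator_of_mem ht f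
  have hFint : Integrable F :=
    (integrable_indicator_iff measurableSet_Ioc).2
      ((intervalIntegrable_iff_integrableOn_Ioc_of_le hT.le).1
        (intervalIntegrable_of_continuousOn_Ici hf.1 le_rfl hT.le))
  have hFM : ∀ t, ‖F t‖ ≤ M := by
    intro t
    by_cases ht : t ∈ Set.Ioc 0 T
    · rw [hFf t ht]; exact hb t ht.1.le
    · rw [hFs t ht, norm_zero]; exact hM.le
  have hFhat : ∀ w, ‖𝓕 F w‖ ≤ κ * T := by
    intro w
    refine le_of_eq_of_le ?_ (hT₂ (-2 * Real.pi * w) T hTb hT.le)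
    rw [Real.fourier_real_eq_integral_exp_smul, intervalIntegral.integral_of_le hT.le,
      ← integral_indicator measurableSet_Ioc]
    congr 2
    funext t
    by_cases ht : t ∈ Set.Ioc 0 T
    · rw [hFf t ht, Set.indicator_of_mem ht, char, smul_eq_mul]
      congr 2
      push_cast; ring
    · rw [hFs t ht, Set.indicator_of_notMem ht, smul_zero]
  obtain ⟨hGi, hGle⟩ := integral_norm_sq_autocorrelation_le hT hFint hFM hFs hFhat
  have hF2 : ∫ t in (-T)..T, ‖F t‖ ^ 2 ≤ M ^ 2 * T := by
    have e : ∀ t, ‖F t‖ ^ 2 = (Set.Ioc 0 T).indicator (fun t => ‖f t‖ ^ 2) t := by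
      intro t
      by_cases ht : t ∈ Set.Ioc 0 T
      · rw [hFf t ht, Set.indicator_of_mem ht]
      · rw [hFs t ht, Set.indicator_of_notMem ht]; simp
    simp_rw [e]
    rw [intervalIntegral.integral_of_le (by linarith), setIntegral_indicator measurableSet_Ioc,
      Set.inter_eq_self_of_subset_right (Set.Ioc_subset_Ioc_left (by linarith)),
      ← intervalIntegral.integral_of_le hT.le]
    refine (Real.le_norm_self _).trans ((norm_integral_le_of_norm_le_Ici (M := M ^ 2)
      (fun t ht => ?_) le_rfl hT.le).trans (by rw [sub_zero, abs_of_pos hT]))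
    rw [norm_pow, norm_norm]
    exact pow_le_pow_left₀ (norm_nonneg _) (hb t ht) 2
  have hupper : ∫ t in (0 : ℝ)..T / 2, ‖autocorrelation F t‖ ^ 2 ≤ (κ * T) ^ 2 * (M ^ 2 * T) := by
    refine (intervalIntegral.integral_mono_interval (by linarith) (by linarith) (by linarith)
      (Eventually.of_forall fun t => by positivity) hGi).trans (hGle.trans ?_)
    gcongr
  -- near an almost period `t ≤ T / 2` the autocorrelation is close to `∫₀^(T-t) |f|²`
  have hlow : ∀ t, 0 ≤ t → t ≤ T / 2 →
      (∀ s, 0 ≤ s → ‖f (t + s) - f s‖ ≤ m / (4 * M)) → m * T / 4 ≤ ‖autocorrelation F t‖ := by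
    intro t ht ht2 hts
    have hTt : 0 ≤ T - t := by linarith
    have e1 : autocorrelation F t = ∫ s in (0 : ℝ)..(T - t), f (t + s) * conj (f s) := by
      rw [autocorrelation, intervalIntegral.integral_of_le hTt,
        ← integral_indicator measurableSet_Ioc]
      refine integral_congr_ae (Eventually.of_forall fun s => ?_)
      simp only
      by_cases hs : s ∈ Set.Ioc 0 (T - t)
      · rw [Set.indicator_of_mem hs, hFf s ⟨hs.1, by linarith [hs.2]⟩,
          hFf (t + s) ⟨by linarith [hs.1], by linarith [hs.2]⟩]
      · rw [Set.indicator_of_notMem hs]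
        by_cases hs0 : 0 < s
        · rw [hFs (t + s) fun h => hs ⟨hs0, by linarith [h.2]⟩, zero_mul]
        · rw [hFs s fun h => hs0 h.1, map_zero, mul_zero]
    have hc1 : ContinuousOn (fun s => f (t + s) * conj (f s)) (Set.Ici 0) :=
      (hf.1.comp (by fun_prop) fun s hs => add_nonneg ht (Set.mem_Ici.1 hs)).mul
        (Complex.continuous_conj.comp_continuousOn hf.1)
    have hc2 : ContinuousOn (fun s => ((‖f s‖ ^ 2 : ℝ) : ℂ)) (Set.Ici 0) :=
      Complex.continuous_ofReal.comp_continuousOn (hf.1.norm.pow 2)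
    have h1 : ‖autocorrelation F t - ((∫ s in (0 : ℝ)..(T - t), ‖f s‖ ^ 2 : ℝ) : ℂ)‖
        ≤ m / 4 * (T - t) := by
      rw [e1, ← intervalIntegral.integral_ofReal, ← intervalIntegral.integral_sub
        (intervalIntegrable_of_continuousOn_Ici hc1 le_rfl hTt)
        (intervalIntegrable_of_continuousOn_Ici hc2 le_rfl hTt)]
      refine (norm_integral_le_of_norm_le_Ici (M := m / 4) (fun s hs => ?_) le_rfl hTt).trans
        (by rw [sub_zero, abs_of_nonneg hTt])
      have e2 : ((‖f s‖ ^ 2 : ℝ) : ℂ) = f s * conj (f s) := by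
        rw [Complex.mul_conj, Complex.normSq_eq_norm_sq]
      rw [e2, ← sub_mul, norm_mul, RCLike.norm_conj]
      calc _ ≤ m / (4 * M) * M := by
            gcongr
            exacts [hts s hs, hb s hs]
        _ = m / 4 := by field_simp
    have h2 := hms (T - t) (by linarith) hTt
    have h3 := norm_sub_norm_le ((∫ s in (0 : ℝ)..(T - t), ‖f s‖ ^ 2 : ℝ) : ℂ) (autocorrelation F t)
    rw [norm_sub_rev, Complex.norm_real] at h3
    have h4 := Real.le_norm_self (∫ s in (0 : ℝ)..(T - t), ‖f s‖ ^ 2)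
    nlinarith
  have hlower := mul_le_integral_of_relatively_dense
    (h := fun t => ‖autocorrelation F t‖ ^ 2) (T := T / 2) (c := (m * T / 4) ^ 2) hl hη
    (by positivity) (by positivity) (fun t => by positivity)
    (hGi.mono_set (by
      rw [Set.uIcc_of_le (by linarith), Set.uIcc_of_le (by linarith)]
      exact Set.Icc_subset_Icc (by linarith) (by linarith))) ?_
  · have h1 : (1 / (4 * (l + η))) * T ≤ T / 2 / (l + η) - 1 := by
      have h2 : 2 ≤ T / 2 / (l + η) := by rw [le_div_iff₀ (by positivity)]; linarith
      have e : 1 / (4 * (l + η)) * T = (T / 2 / (l + η)) / 2 := by field_simp; norm_num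
      rw [e]; linarith
    have h2 : q * T ^ 3 ≤ (m * T / 4) ^ 2 * η * (T / 2 / (l + η) - 1) := by
      calc q * T ^ 3 = (m * T / 4) ^ 2 * η * ((1 / (4 * (l + η))) * T) := by rw [hq]; ring
        _ ≤ _ := by gcongr
    have h3 : (κ * T) ^ 2 * (M ^ 2 * T) = q / 2 * T ^ 3 := by
      rw [mul_pow, hκ2]; field_simp
    have h4 : 0 < q * T ^ 3 := by positivity
    linarith
  · intro a ha haT
    obtain ⟨τ, hτ1, hτ2⟩ := hτ a ha
    refine ⟨τ, hτ1, fun θ hθ => ?_⟩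
    have h1 := hlow (τ + θ) (by linarith [hτ1.1, hθ.1]) (by linarith [hτ1.2, hθ.2]) fun s hs => by
      have h2 := hτ2 (s + θ) (by linarith [hθ.1])
      have h3 := huc s (s + θ) hs (by linarith [hθ.1]) (by linarith [hθ.2])
      have h4 := norm_sub_le_norm_sub_add_norm_sub (f (s + θ + τ)) (f (s + θ)) (f s)
      rw [show τ + θ + s = s + θ + τ by ring]
      have e : m / (4 * M) = m / (8 * M) + m / (8 * M) := by field_simp; norm_num
      linarith
    have h5 : 0 ≤ m * T / 4 := by positivity
    gcongr

open scoped Pointwise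

/-! ### Translations of test functions -/

/-- The translate `φ(· - t)` of a test function. -/
noncomputable def translate (t : ℝ) (φ : TestFun) : TestFun where
  toFun := fun s => φ (s - t)
  contDiff' := φ.contDiff.comp (contDiff_id.sub contDiff_const)
  hasCompactSupport' := φ.hasCompactSupport.comp_homeomorph (Homeomorph.subRight t)
  tsupport_subset' := Set.subset_univ _

@[simp]
theorem translate_apply (t : ℝ) (φ : TestFun) (s : ℝ) : translate t φ s = φ (s - t) := rfl

theorem translate_zero (φ : TestFun) : translate 0 φ = φ := by
  ext s; simp

/-- The derivative `φ'` of a test function. -/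
noncomputable def derivTest : TestFun →L[ℂ] TestFun := TestFunction.lineDerivCLM ℂ (1 : ℝ)

theorem derivTest_apply (φ : TestFun) (s : ℝ) : derivTest φ s = deriv φ s := by
  rw [derivTest, TestFunction.lineDerivCLM_apply_of_le (by simp), lineDeriv]
  simp only [smul_eq_mul, mul_one]
  rw [deriv_comp_const_add, add_zero]

theorem derivTest_translate (t : ℝ) (φ : TestFun) :
    derivTest (translate t φ) = translate t (derivTest φ) := by
  ext s
  rw [derivTest_apply, translate_apply, derivTest_apply]
  exact deriv_comp_sub_const (f := φ) t s

theorem derivTest_mem_testFunNonneg {φ : TestFun} (hφ : φ ∈ testFunNonneg) :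
    derivTest φ ∈ testFunNonneg := by
  have h : (derivTest φ : ℝ → ℂ) = deriv φ := funext (derivTest_apply φ)
  change tsupport (derivTest φ : ℝ → ℂ) ⊆ _
  rw [h]
  exact (closure_minimal support_deriv_subset (isClosed_tsupport _)).trans hφ

theorem tsupport_translate (t : ℝ) (φ : TestFun) :
    tsupport (translate t φ : ℝ → ℂ) = (fun s => s - t) ⁻¹' tsupport (φ : ℝ → ℂ) :=
  tsupport_comp_eq_preimage (φ : ℝ → ℂ) (Homeomorph.subRight t)

theorem translate_mem_testFunNonneg {φ : TestFun} (hφ : φ ∈ testFunNonneg) {t : ℝ} (ht : 0 ≤ t) :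
    translate t φ ∈ testFunNonneg := by
  change tsupport (translate t φ : ℝ → ℂ) ⊆ _
  rw [tsupport_translate]
  intro s hs
  have : (0 : ℝ) ≤ s - t := hφ hs
  exact Set.mem_Ici.2 (by linarith)

/-- A continuous linear map on test functions has finite order on each compact set. -/
theorem exists_norm_le_of_tsupport_subset {G : Type*} [NormedAddCommGroup G] [NormedSpace ℂ G]
    (L : TestFun →L[ℂ] G) {K : Set ℝ} (hK : IsCompact K) :
    ∃ (N : ℕ) (C : ℝ), ∀ ψ : TestFun, tsupport (ψ : ℝ → ℂ) ⊆ K → ∀ B, 0 ≤ B →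
      (∀ i ≤ N, ∀ x, ‖iteratedDeriv i ψ x‖ ≤ B) → ‖L ψ‖ ≤ C * B := by
  let K' : TopologicalSpace.Compacts ℝ := ⟨K, hK⟩
  have hK' : (K' : Set ℝ) ⊆ ((⊤ : TopologicalSpace.Opens ℝ) : Set ℝ) := Set.subset_univ _
  let LK := L.comp (TestFunction.ofSupportedInCLM (n := ⊤) (F := ℂ) ℂ hK')
  let p := (normSeminorm ℂ G).comp LK.toLinearMap
  have hp : Continuous p := continuous_norm.comp LK.continuous
  obtain ⟨s, C, -, hC⟩ := Seminorm.bound_of_continuous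
    (ContDiffMapSupportedIn.withSeminorms ℂ ℝ ℂ ⊤ K') p hp
  refine ⟨s.sup id, C, fun ψ hψ B hB h => ?_⟩
  let f : ContDiffMapSupportedIn ℝ ℂ ⊤ K' := .of_support_subset ψ.contDiff
    ((subset_tsupport _).trans hψ)
  have h1 : p f ≤ C * B := by
    refine (hC f).trans ?_
    rw [smul_apply, NNReal.smul_def, smul_eq_mul]
    refine mul_le_mul_of_nonneg_left ?_ C.2
    refine Seminorm.finset_sup_apply_le hB fun i hi => ?_
    rw [ContDiffMapSupportedIn.seminorm_top_le_iff ℂ hB]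
    intro x _
    rw [norm_iteratedFDeriv_eq_norm_iteratedDeriv]
    exact h i (Finset.le_sup (f := id) hi) x
  exact h1

/-- First order Taylor expansion with a remainder that is uniform in the base point. -/
theorem exists_norm_sub_add_smul_deriv_le {ψ : ℝ → ℂ} (hψ : ContDiff ℝ 2 ψ)
    (hs : HasCompactSupport ψ) :
    ∃ B, 0 ≤ B ∧ ∀ y h : ℝ, ‖ψ (y - h) - ψ y + h * deriv ψ y‖ ≤ B * h ^ 2 := by
  have hd1 : ContDiff ℝ 1 (deriv ψ) := ((contDiff_succ_iff_deriv (n := 1)).1 hψ).2.2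
  obtain ⟨B, hB⟩ := (hs.deriv.deriv).exists_bound_of_continuous (hd1.continuous_deriv le_rfl)
  have hB0 : 0 ≤ B := (norm_nonneg _).trans (hB 0)
  have hlip : ∀ a b, ‖deriv ψ b - deriv ψ a‖ ≤ B * ‖b - a‖ := fun a b =>
    convex_univ.norm_image_sub_le_of_norm_deriv_le
      (fun x _ => hd1.differentiable one_ne_zero x) (fun x _ => hB x) trivial trivial
  refine ⟨B, hB0, fun y h => ?_⟩
  have hder : ∀ k : ℝ, HasDerivAt (fun k : ℝ => ψ (y - k) - ψ y + k * deriv ψ y)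
      (-deriv ψ (y - k) + deriv ψ y) k := by
    intro k
    have h1 : HasDerivAt (fun k : ℝ => ψ (y - k)) (-deriv ψ (y - k)) k := by
      simpa using (hψ.differentiable two_ne_zero (y - k)).hasDerivAt.comp_const_sub y k
    have h2 : HasDerivAt (fun k : ℝ => (k : ℂ) * deriv ψ y) (deriv ψ y) k := by
      simpa using (Complex.ofRealCLM.hasDerivAt (x := k)).mul_const (deriv ψ y)
    exact (h1.sub_const _).add h2
  have h3 := (convex_Icc (-|h|) |h|).norm_image_sub_le_of_norm_hasDerivWithin_le (C := B * |h|)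
    (x := 0) (y := h) (fun k _ => (hder k).hasDerivWithinAt) (fun k hk => ?_)
    ⟨by simp, abs_nonneg h⟩ ⟨neg_abs_le h, le_abs_self h⟩
  · simp only [sub_zero, sub_self, Complex.ofReal_zero, zero_mul, add_zero] at h3
    refine h3.trans_eq ?_
    rw [Real.norm_eq_abs, mul_assoc, ← pow_two, sq_abs]
  · have h4 := hlip (y - k) y
    rw [neg_add_eq_sub]
    refine h4.trans ?_
    rw [sub_sub_cancel, Real.norm_eq_abs]
    exact mul_le_mul_of_nonneg_left (abs_le.2 hk) hB0

/-- Translation is differentiable in the space of test functions, tested against a continuous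
linear map. -/
theorem hasDerivAt_translate {G : Type*} [NormedAddCommGroup G] [NormedSpace ℂ G]
    (L : TestFun →L[ℂ] G) (φ : TestFun) (s : ℝ) :
    HasDerivAt (fun s => L (translate s φ)) (-L (translate s (derivTest φ))) s := by
  have hK : IsCompact (tsupport (φ : ℝ → ℂ) + Set.Icc (s - 1) (s + 1)) :=
    φ.hasCompactSupport.isCompact.add isCompact_Icc
  obtain ⟨N, C, hC⟩ := exists_norm_le_of_tsupport_subset L hK
  have hsm : ∀ n : ℕ, ContDiff ℝ n φ := fun n => φ.contDiff.of_le (by exact_mod_cast le_top)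
  have htay : ∀ i : ℕ, ∃ B, 0 ≤ B ∧ ∀ y h : ℝ, ‖iteratedDeriv i φ (y - h) - iteratedDeriv i φ y
      + h * iteratedDeriv (i + 1) φ y‖ ≤ B * h ^ 2 := by
    intro i
    simp_rw [iteratedDeriv_succ]
    refine exists_norm_sub_add_smul_deriv_le ?_ ?_
    · rw [iteratedDeriv_eq_iterate]
      exact ContDiff.iterate_deriv' 2 i (hsm (2 + i))
    · refine φ.hasCompactSupport.mono' ?_
      exact Function.support_subset_iff'.2 fun x hx =>
        norm_eq_zero.1 (by
          rw [← norm_iteratedFDeriv_eq_norm_iteratedDeriv, norm_eq_zero]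
          by_contra h
          exact hx (support_iteratedFDeriv_subset i h))
  choose B hB0 hB using htay
  set B' := ∑ i ∈ Finset.range (N + 1), B i with hB'
  have hBi : ∀ i ≤ N, B i ≤ B' := fun i hi =>
    Finset.single_le_sum (fun j _ => hB0 j) (Finset.mem_range.2 (by omega))
  have hB'0 : 0 ≤ B' := Finset.sum_nonneg fun j _ => hB0 j
  have key : ∀ h : ℝ, |h| ≤ 1 →
      ‖L (translate (s + h) φ) - L (translate s φ) - h • -L (translate s (derivTest φ))‖
        ≤ C * B' * ‖h ^ 2‖ := by
    intro h hh
    set R : TestFun := translate (s + h) φ - translate s φ + (h : ℂ) • translate s (derivTest φ)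
      with hR
    have e1 : L (translate (s + h) φ) - L (translate s φ) - h • -L (translate s (derivTest φ))
        = L R := by
      rw [hR, map_add, map_sub, map_smul, smul_neg, sub_neg_eq_add]; rfl
    have e2 : (R : ℝ → ℂ) = fun x => φ (x - (s + h)) - φ (x - s) + (h : ℂ) * deriv φ (x - s) := by
      funext x
      rw [← derivTest_apply]
      rfl
    rw [e1, mul_assoc]
    refine hC R ?_ _ (by positivity) fun i hi x => ?_
    · refine closure_minimal (Function.support_subset_iff'.2 fun x hx => ?_) hK.isClosed
      rw [abs_le] at hh
      have h1 : x - (s + h) ∉ tsupport (φ : ℝ → ℂ) := fun h1 =>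
        hx ⟨_, h1, s + h, ⟨by linarith, by linarith⟩, by simp⟩
      have h2 : x - s ∉ tsupport (φ : ℝ → ℂ) := fun h2 =>
        hx ⟨_, h2, s, ⟨by linarith, by linarith⟩, by simp⟩
      have h3 : deriv φ (x - s) = 0 := by
        by_contra h3
        exact h2 (support_deriv_subset h3)
      rw [e2]
      simp only
      rw [image_eq_zero_of_notMem_tsupport h1, image_eq_zero_of_notMem_tsupport h2, h3]
      simp
    · have hdsm : ContDiff ℝ i (deriv φ) := by
        have := hsm (i + 1)
        push_cast at this
        exact (contDiff_succ_iff_deriv.1 this).2.2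
      have c1 : ContDiff ℝ i (fun x => φ (x - (s + h))) :=
        (hsm i).comp (contDiff_id.sub contDiff_const)
      have c2 : ContDiff ℝ i (fun x => φ (x - s)) := (hsm i).comp (contDiff_id.sub contDiff_const)
      have c3 : ContDiff ℝ i (fun x => deriv φ (x - s)) :=
        hdsm.comp (contDiff_id.sub contDiff_const)
      rw [e2, iteratedDeriv_fun_add (c1.sub c2).contDiffAt (contDiff_const.mul c3).contDiffAt,
        iteratedDeriv_fun_sub c1.contDiffAt c2.contDiffAt, iteratedDeriv_const_mul_field,
        iteratedDeriv_comp_sub_const, iteratedDeriv_comp_sub_const, iteratedDeriv_comp_sub_const,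
        ← iteratedDeriv_succ']
      have h1 := hB i (x - s) h
      rw [sub_sub] at h1
      refine h1.trans ?_
      rw [Real.norm_eq_abs, abs_of_nonneg (sq_nonneg h)]
      gcongr
      exact hBi i hi
  rw [hasDerivAt_iff_isLittleO_nhds_zero]
  refine Asymptotics.IsBigO.trans_isLittleO (g := fun h : ℝ => h ^ 2) ?_
    (Asymptotics.isLittleO_pow_id one_lt_two)
  refine Asymptotics.IsBigO.of_bound (C * B') ?_
  filter_upwards [Metric.closedBall_mem_nhds (0 : ℝ) one_pos] with h hh
  exact key h (by simpa using hh)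

theorem continuous_translate {G : Type*} [NormedAddCommGroup G] [NormedSpace ℂ G]
    (L : TestFun →L[ℂ] G) (φ : TestFun) : Continuous fun s => L (translate s φ) :=
  continuous_iff_continuousAt.2 fun s => (hasDerivAt_translate L φ s).continuousAt

/-! ### The operators `G(δ_t)` and `G(-δ')` -/

variable {E : Type*} [NormedAddCommGroup E] [NormedSpace ℂ E]

theorem mem_graphG_dirac {𝒢 : TestFun →L[ℂ] (E →L[ℂ] E)} {t : ℝ} {x y : E} :
    (x, y) ∈ graphG 𝒢 (dirac t) ↔ ∀ φ ∈ testFunNonneg, 𝒢 (translate t φ) x = 𝒢 φ y := by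
  refine ⟨fun h φ hφ => h φ hφ _ fun s => rfl, fun h φ hφ χ hχ => ?_⟩
  obtain rfl : χ = translate t φ := TestFunction.ext hχ
  exact h φ hφ

theorem convolve_neg_distDeriv_dirac (φ : TestFun) (t : ℝ) :
    convolve (-distDeriv (dirac 0)) φ t = (-derivTest φ : TestFun) t := by
  have h1 : convolve (-distDeriv (dirac 0)) φ t = derivTest (reflect t φ) 0 := by
    change - -(derivTest (reflect t φ) 0) = _
    rw [neg_neg]
  rw [h1, derivTest_apply]
  change deriv (fun s => φ (t - s)) 0 = -(derivTest φ t)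
  rw [derivTest_apply, deriv_comp_const_sub, sub_zero]

theorem mem_graph_iff {𝒢 : TestFun →L[ℂ] (E →L[ℂ] E)} {A : E →ₗ.[ℂ] E} (hA : IsGenerator 𝒢 A)
    {x y : E} : (x, y) ∈ A.graph ↔ ∀ φ ∈ testFunNonneg, -𝒢 (derivTest φ) x = 𝒢 φ y := by
  rw [← SetLike.mem_coe, show (A.graph : Set (E × E)) = _ from hA]
  have e : ∀ φ, 𝒢 (-derivTest φ) x = -𝒢 (derivTest φ) x := fun φ => by rw [map_neg]; rfl
  refine ⟨fun h φ hφ => ?_, fun h φ hφ χ hχ => ?_⟩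
  · rw [← e]
    exact h φ hφ _ fun s => (convolve_neg_distDeriv_dirac φ s).symm
  · obtain rfl : χ = -derivTest φ :=
      TestFunction.ext fun s => (hχ s).trans (convolve_neg_distDeriv_dirac φ s)
    rw [e]
    exact h φ hφ

/-! ### Mild solutions -/

/-- A mild solution of the abstract Cauchy problem with initial value `x` is the orbit
`t ↦ G(δ_t)x`. Writing `V t = ∫₀ᵗ v`, the function `s ↦ 𝒢(φ(· - (t - s))) V s` has derivative
`𝒢(φ(· - (t - s))) x`, so that `𝒢(φ) V t = ∫₀ᵗ 𝒢(φ(· - s)) x ds`; differentiate in `t`. -/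
theorem mem_graphG_dirac_of_mild_solution [CompleteSpace E] {𝒢 : TestFun →L[ℂ] (E →L[ℂ] E)}
    {A : E →ₗ.[ℂ] E} (hA : IsGenerator 𝒢 A) {v : ℝ → E} {x : E} (hv : ContinuousOn v (Set.Ici 0))
    (hmild : ∀ t : ℝ, 0 ≤ t → (∫ s in (0 : ℝ)..t, v s, v t - x) ∈ A.graph) {t : ℝ} (ht : 0 ≤ t) :
    (x, v t) ∈ graphG 𝒢 (dirac t) := by
  rw [mem_graphG_dirac]
  intro φ hφ
  -- a continuous extension of `v` to the whole line
  set w : ℝ → E := fun t => v (max t 0) with hw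
  have hwc : Continuous w :=
    hv.comp_continuous (by fun_prop) fun t => Set.mem_Ici.2 (le_max_right t 0)
  have hwv : ∀ t, 0 ≤ t → w t = v t := fun t ht => by simp [hw, ht]
  have hmild' : ∀ t : ℝ, 0 ≤ t → (∫ s in (0 : ℝ)..t, w s, w t - x) ∈ A.graph := by
    intro t ht
    have e : (∫ s in (0 : ℝ)..t, w s) = ∫ s in (0 : ℝ)..t, v s :=
      intervalIntegral.integral_congr fun s hs => by
        rw [Set.uIcc_of_le ht] at hs
        exact hwv s hs.1
    rw [e, hwv t ht]
    exact hmild t ht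
  set W : ℝ → E := fun t => ∫ s in (0 : ℝ)..t, w s with hW
  have hWd : ∀ t, HasDerivAt W (w t) t := fun t =>
    intervalIntegral.integral_hasDerivAt_right (hwc.intervalIntegrable _ _)
      hwc.stronglyMeasurable.stronglyMeasurableAtFilter hwc.continuousAt
  set g : ℝ → E := fun s => 𝒢 (translate s φ) x with hg
  have hgc : Continuous g := (continuous_translate 𝒢 φ).clm_apply continuous_const
  have hint : ∀ t, 0 ≤ t → 𝒢 φ (W t) = ∫ s in (0 : ℝ)..t, g s := by
    intro t ht
    have hd : ∀ s ∈ Set.uIcc 0 t,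
        HasDerivAt (fun s => 𝒢 (translate (t - s) φ) (W s)) (g (t - s)) s := by
      intro s hs
      rw [Set.uIcc_of_le ht] at hs
      have h1 : HasDerivAt (fun s => 𝒢 (translate (t - s) φ))
          (𝒢 (translate (t - s) (derivTest φ))) s := by
        simpa using (hasDerivAt_translate 𝒢 φ (t - s)).comp_const_sub t s
      have h1' : HasDerivAt (fun s => (𝒢 (translate (t - s) φ)).restrictScalars ℝ)
          ((𝒢 (translate (t - s) (derivTest φ))).restrictScalars ℝ) s :=
        (ContinuousLinearMap.restrictScalarsL ℂ E E ℝ ℝ).hasFDerivAt.comp_hasDerivAt s h1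
      refine (h1'.clm_apply (hWd s)).congr_deriv ?_
      have h2 := (mem_graph_iff hA).1 (hmild' s hs.1) (translate (t - s) φ)
        (translate_mem_testFunNonneg hφ (by linarith [hs.2]))
      rw [derivTest_translate, map_sub] at h2
      change 𝒢 (translate (t - s) (derivTest φ)) (W s) + 𝒢 (translate (t - s) φ) (w s) = g (t - s)
      rw [show 𝒢 (translate (t - s) (derivTest φ)) (W s) = _ from neg_eq_iff_eq_neg.1 h2]
      simp [hg]
    have h3 := intervalIntegral.integral_eq_sub_of_hasDerivAt hd
      ((hgc.comp (by fun_prop)).intervalIntegrable _ _)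
    rw [intervalIntegral.integral_comp_sub_left] at h3
    simpa [hW, translate_zero] using h3.symm
  have hd0 : HasDerivWithinAt (fun s => 𝒢 φ (W s) - ∫ r in (0 : ℝ)..s, g r) (𝒢 φ (w t) - g t)
      (Set.Ici t) t :=
    (((𝒢 φ).restrictScalars ℝ).hasFDerivAt.comp_hasDerivAt t (hWd t)).sub
      (intervalIntegral.integral_hasDerivAt_right (hgc.intervalIntegrable _ _)
        hgc.stronglyMeasurable.stronglyMeasurableAtFilter hgc.continuousAt) |>.hasDerivWithinAt
  have hd1 : HasDerivWithinAt (fun s => 𝒢 φ (W s) - ∫ r in (0 : ℝ)..s, g r) 0 (Set.Ici t) t :=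
    (hasDerivWithinAt_const t (Set.Ici t) (0 : E)).congr
      (fun s hs => sub_eq_zero.2 (hint s (ht.trans hs))) (sub_eq_zero.2 (hint t ht))
  have h := (uniqueDiffWithinAt_Ici t).eq_deriv _ hd0 hd1
  rw [sub_eq_zero, hwv t ht] at h
  exact h.symm

theorem eq_of_mem_graphG_dirac {C : E →L[ℂ] E} {𝒢 : TestFun →L[ℂ] (E →L[ℂ] E)}
    (h𝒢 : IsCDistSemigroup C 𝒢) {t : ℝ} {x y z : E} (hy : (x, y) ∈ graphG 𝒢 (dirac t))
    (hz : (x, z) ∈ graphG 𝒢 (dirac t)) : y = z := by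
  rw [mem_graphG_dirac] at hy hz
  refine sub_eq_zero.1 (h𝒢.kernel _ fun φ hφ => ?_)
  rw [map_sub, ← hy φ hφ, ← hz φ hφ, sub_self]

theorem mem_graphG_dirac_zero {𝒢 : TestFun →L[ℂ] (E →L[ℂ] E)} (x : E) :
    (x, x) ∈ graphG 𝒢 (dirac 0) := by
  rw [mem_graphG_dirac]
  intro φ _
  rw [translate_zero]

/-- The orbit of an initial value in the solution space is continuous. -/
theorem continuousOn_orbit [CompleteSpace E] {C : E →L[ℂ] E} {𝒢 : TestFun →L[ℂ] (E →L[ℂ] E)}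
    (h𝒢 : IsCDistSemigroup C 𝒢) {A : E →ₗ.[ℂ] E} (hA : IsGenerator 𝒢 A) {x : E}
    (hx : x ∈ solutionSpace A) {u : ℝ → E}
    (hu : ∀ t : ℝ, 0 ≤ t → (x, u t) ∈ graphG 𝒢 (dirac t)) : ContinuousOn u (Set.Ici 0) := by
  obtain ⟨v, hv, hmild⟩ := hx
  exact hv.congr fun t ht => eq_of_mem_graphG_dirac h𝒢 (hu t ht)
    (mem_graphG_dirac_of_mild_solution hA hv hmild ht)

/-! ### Fourier–Bohr means of orbits -/

theorem hasDerivAt_char (r t : ℝ) : HasDerivAt (char r) (Complex.I * r * char r t) t := by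
  have h1 : HasDerivAt (fun t : ℝ => Complex.I * ((r * t : ℝ) : ℂ)) (Complex.I * r) t := by
    simpa using (((hasDerivAt_id t).const_mul r).ofReal_comp).const_mul Complex.I
  have h2 := h1.cexp
  rw [mul_comm] at h2
  exact h2

theorem clm_mean_char_smul [CompleteSpace E] (ℓ : E →L[ℂ] ℂ) {u : ℝ → E}
    (hu : ContinuousOn u (Set.Ici 0)) (r : ℝ) (n : ℕ) :
    ℓ ((n : ℂ)⁻¹ • ∫ t in (0 : ℝ)..n, char r t • u t)
      = (n : ℂ)⁻¹ * ∫ t in (0 : ℝ)..n, char r t * ℓ (u t) := by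
  rw [map_smul, smul_eq_mul, ← ContinuousLinearMap.intervalIntegral_comp_comm]
  · simp
  · exact intervalIntegrable_of_continuousOn_Ici ((continuous_char r).continuousOn.smul hu) le_rfl
      n.cast_nonneg

/-- In a weakly sequentially complete space, the Fourier–Bohr means of a continuous weakly almost
periodic function converge weakly. -/
theorem IsWeaklyAlmostPeriodic.exists_weak_mean [CompleteSpace E]
    (hE : IsWeaklySequentiallyComplete E) {u : ℝ → E} (hu : ContinuousOn u (Set.Ici 0))
    (hwap : IsWeaklyAlmostPeriodic u) (r : ℝ) :
    ∃ y : E, ∀ ℓ : E →L[ℂ] ℂ,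
      Tendsto (fun n : ℕ => (n : ℂ)⁻¹ * ∫ t in (0 : ℝ)..n, char r t * ℓ (u t)) atTop (𝓝 (ℓ y)) := by
  obtain ⟨y, hy⟩ := hE (fun n => (n : ℂ)⁻¹ • ∫ t in (0 : ℝ)..n, char r t • u t) fun ℓ => by
    simp_rw [clm_mean_char_smul ℓ hu]
    obtain ⟨c, hc⟩ := (hwap ℓ).exists_mean_char_mul r
    exact hc.cauchySeq
  refine ⟨y, fun ℓ => ?_⟩
  have := hy ℓ
  simp_rw [clm_mean_char_smul ℓ hu] at this
  exact this

/-- The weak Fourier–Bohr mean of an orbit against `t ↦ e^{irt}` satisfies `A y = -ir y`: integrate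
by parts in the means, where the boundary terms are bounded, hence vanish in the limit. -/
theorem weak_mean_mem_graph {𝒢 : TestFun →L[ℂ] (E →L[ℂ] E)} {A : E →ₗ.[ℂ] E}
    (hA : IsGenerator 𝒢 A) {x : E} {u : ℝ → E}
    (hu : ∀ t : ℝ, 0 ≤ t → (x, u t) ∈ graphG 𝒢 (dirac t)) (hwap : IsWeaklyAlmostPeriodic u)
    {r : ℝ} {y : E} (hy : ∀ ℓ : E →L[ℂ] ℂ,
      Tendsto (fun n : ℕ => (n : ℂ)⁻¹ * ∫ t in (0 : ℝ)..n, char r t * ℓ (u t)) atTop (𝓝 (ℓ y))) :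
    (y, (Complex.I * ((-r : ℝ) : ℂ)) • y) ∈ A.graph := by
  rw [mem_graph_iff hA]
  intro φ hφ
  refine (SeparatingDual.eq_iff_forall_dual_eq (R := ℂ)).2 fun ℓ => ?_
  have hφu : ∀ ψ ∈ testFunNonneg, ∀ t, 0 ≤ t → 𝒢 (translate t ψ) x = 𝒢 ψ (u t) :=
    fun ψ hψ t ht => mem_graphG_dirac.1 (hu t ht) ψ hψ
  set p : ℝ → ℂ := fun t => ℓ (𝒢 (translate t φ) x) with hp
  set p' : ℝ → ℂ := fun t => -ℓ (𝒢 (translate t (derivTest φ)) x) with hp'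
  let Lx : TestFun →L[ℂ] ℂ := ℓ.comp ((ContinuousLinearMap.apply ℂ E x).comp 𝒢)
  have hpd : ∀ t, HasDerivAt p (p' t) t := fun t => hasDerivAt_translate Lx φ t
  have hp'c : Continuous p' := (continuous_translate Lx (derivTest φ)).neg
  have hcd : Continuous fun t => Complex.I * r * char r t :=
    continuous_const.mul (continuous_char r)
  obtain ⟨M, hM, hb⟩ := (hwap (ℓ.comp (𝒢 φ))).exists_bound
  have hpM : ∀ t, 0 ≤ t → ‖p t‖ ≤ M := fun t ht => by
    rw [hp]; simp only; rw [hφu φ hφ t ht]; exact hb t ht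
  have hparts : ∀ n : ℕ, (n : ℂ)⁻¹ * (∫ t in (0 : ℝ)..n, char r t * ℓ (𝒢 (derivTest φ) (u t)))
      = Complex.I * r * ((n : ℂ)⁻¹ * ∫ t in (0 : ℝ)..n, char r t * ℓ (𝒢 φ (u t)))
        - (n : ℂ)⁻¹ * (char r n * p n - p 0) := by
    intro n
    have h1 := intervalIntegral.integral_mul_deriv_eq_deriv_mul (a := 0) (b := n)
      (fun t _ => hasDerivAt_char r t) (fun t _ => hpd t) (hcd.intervalIntegrable _ _)
      (hp'c.intervalIntegrable _ _)
    have h2 : (∫ t in (0 : ℝ)..n, char r t * p' t)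
        = -∫ t in (0 : ℝ)..n, char r t * ℓ (𝒢 (derivTest φ) (u t)) := by
      rw [← intervalIntegral.integral_neg]
      refine intervalIntegral.integral_congr fun t ht => ?_
      rw [Set.uIcc_of_le n.cast_nonneg] at ht
      simp only [hp']
      rw [hφu _ (derivTest_mem_testFunNonneg hφ) t ht.1, mul_neg]
    have h3 : (∫ t in (0 : ℝ)..n, Complex.I * r * char r t * p t)
        = Complex.I * r * ∫ t in (0 : ℝ)..n, char r t * ℓ (𝒢 φ (u t)) := by
      rw [← intervalIntegral.integral_const_mul]
      refine intervalIntegral.integral_congr fun t ht => ?_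
      rw [Set.uIcc_of_le n.cast_nonneg] at ht
      simp only [hp]
      rw [hφu _ hφ t ht.1, mul_assoc]
    rw [h2, h3, char_zero_right, one_mul] at h1
    linear_combination (-(n : ℂ)⁻¹) * h1
  have hbdry : Tendsto (fun n : ℕ => (n : ℂ)⁻¹ * (char r n * p n - p 0)) atTop (𝓝 0) := by
    refine squeeze_zero_norm (a := fun n : ℕ => 2 * M / n) (fun n => ?_)
      (tendsto_const_div_atTop_nhds_zero_nat _)
    rw [norm_mul, norm_inv, Complex.norm_natCast, inv_mul_eq_div]
    gcongr
    refine (norm_sub_le _ _).trans ?_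
    rw [norm_char_mul]
    linarith [hpM n n.cast_nonneg, hpM 0 le_rfl]
  have h1 := hy (ℓ.comp (𝒢 (derivTest φ)))
  have h2 := ((hy (ℓ.comp (𝒢 φ))).const_mul (Complex.I * r)).sub hbdry
  simp only [ContinuousLinearMap.comp_apply] at h1 h2
  have h3 := tendsto_nhds_unique h1 (h2.congr fun n => (hparts n).symm)
  rw [map_neg, h3, map_smul, map_smul, smul_eq_mul]
  push_cast
  ring

/-! ### Density of the span of the imaginary eigenvectors -/

theorem dense_of_forall_dual_eq_zero (S : Submodule ℂ E)
    (h : ∀ ℓ : E →L[ℂ] ℂ, (∀ x ∈ S, ℓ x = 0) → ℓ = 0) : Dense (S : Set E) := by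
  rw [Submodule.dense_iff_topologicalClosure_eq_top, Submodule.eq_top_iff']
  intro x
  have : IsClosed (S.topologicalClosure : Set E) := S.isClosed_topologicalClosure
  by_contra hx
  have hx' : S.topologicalClosure.mkQ x ≠ 0 := by
    rwa [Ne, Submodule.mkQ_apply, Submodule.Quotient.mk_eq_zero]
  obtain ⟨f, hf⟩ := SeparatingDual.exists_ne_zero (R := ℂ) hx'
  have h0 := h (f.comp S.topologicalClosure.mkQL) fun y hy => by
    have : S.topologicalClosure.mkQ y = 0 := by
      rw [Submodule.mkQ_apply, Submodule.Quotient.mk_eq_zero]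
      exact S.le_topologicalClosure hy
    change f (S.topologicalClosure.mkQ y) = 0
    rw [this, map_zero]
  exact hf (DFunLike.congr_fun h0 x)

theorem dense_span_imaginaryEigenvectors [CompleteSpace E] {C : E →L[ℂ] E}
    {𝒢 : TestFun →L[ℂ] (E →L[ℂ] E)} (h𝒢 : IsCDistSemigroup C 𝒢) {A : E →ₗ.[ℂ] E}
    (hA : IsGenerator 𝒢 A) {V : Submodule ℂ E} (hV : IsSubspaceWeaklyAlmostPeriodic 𝒢 A V)
    (hVdense : Dense (V : Set E)) (hE : IsWeaklySequentiallyComplete E) :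
    Dense (Submodule.span ℂ (imaginaryEigenvectors A) : Set E) := by
  refine dense_of_forall_dual_eq_zero _ fun ℓ hℓ => ?_
  have hzero : ∀ x ∈ V, ℓ x = 0 := by
    intro x hx
    obtain ⟨u, hu, hwap⟩ := hV.2 x hx
    have huc := continuousOn_orbit h𝒢 hA (hV.1 hx) hu
    have hu0 : u 0 = x := eq_of_mem_graphG_dirac h𝒢 (hu 0 le_rfl) (mem_graphG_dirac_zero x)
    rw [← hu0]
    refine (hwap ℓ).apply_zero_eq_zero fun r => ?_
    obtain ⟨y, hy⟩ := hwap.exists_weak_mean hE huc r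
    have hyA := weak_mean_mem_graph hA hu hwap hy
    have hy0 : ℓ y = 0 := by
      by_cases h : y = 0
      · rw [h, map_zero]
      · exact hℓ y (Submodule.subset_span ⟨h, -r, hyA⟩)
    rw [← hy0]
    exact hy ℓ
  exact DFunLike.coe_injective (Continuous.ext_on hVdense ℓ.continuous
    (0 : E →L[ℂ] ℂ).continuous fun x hx => hzero x hx)

/-! ### Trigonometric polynomials -/

/-- Finitely many characters have arbitrarily good common almost periods, because the orbit
`t ↦ (e^{i r_j t})_j` is totally bounded. -/
theorem exists_common_almost_period {n : ℕ} (r : Fin n → ℝ) {ε : ℝ} (hε : 0 < ε) :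
    ∃ l : ℝ, 0 < l ∧ ∀ a : ℝ, 0 ≤ a → ∃ τ ∈ Set.Icc a (a + l), ∀ i, ‖char (r i) τ - 1‖ ≤ ε := by
  set γ : ℝ → Fin n → ℂ := fun t i => char (r i) t
  have hbdd : Bornology.IsBounded (γ '' Set.Ici 0) := by
    refine isBounded_iff_forall_norm_le.2 ⟨1, ?_⟩
    rintro _ ⟨t, -, rfl⟩
    exact (pi_norm_le_iff_of_nonneg zero_le_one).2 fun i => (norm_char _ _).le
  have htb : TotallyBounded (γ '' Set.Ici 0) :=
    hbdd.isCompact_closure.totallyBounded.subset subset_closure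
  obtain ⟨s, hs, hsfin, hcover⟩ := Metric.finite_approx_of_totallyBounded htb ε hε
  obtain ⟨N, hN, hNfin, rfl⟩ := hsfin.exists_subset_finite_image_eq hs
  obtain ⟨L, hL⟩ := hNfin.bddAbove
  refine ⟨max L 1, by positivity, fun a ha => ?_⟩
  have hmem : γ (a + max L 1) ∈ γ '' Set.Ici 0 :=
    ⟨_, Set.mem_Ici.2 (add_nonneg ha (zero_le_one.trans (le_max_right _ _))), rfl⟩
  obtain ⟨_, ⟨t, ht, rfl⟩, hd⟩ := Set.mem_iUnion₂.1 (hcover hmem)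
  have ht0 : (0 : ℝ) ≤ t := hN ht
  have htL : t ≤ max L 1 := (hL ht).trans (le_max_left _ _)
  refine ⟨a + max L 1 - t, ⟨by linarith, by linarith⟩, fun i => ?_⟩
  have e : char (r i) t * (char (r i) (a + max L 1 - t) - 1)
      = γ (a + max L 1) i - γ t i := by
    simp only [γ]
    rw [mul_sub, ← char_add, mul_one, add_sub_cancel]
  rw [← norm_char_mul (r i) t, e, ← dist_eq_norm]
  exact (dist_le_pi_dist _ _ i).trans (Metric.mem_ball.1 hd).le

theorem isAlmostPeriodic_sum_char_smul {n : ℕ} (r : Fin n → ℝ) (y : Fin n → E) :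
    IsAlmostPeriodic fun t => ∑ i, char (r i) t • y i := by
  refine ⟨(continuous_finsetSum _ fun i _ =>
    (continuous_char (r i)).smul continuous_const).continuousOn, fun ε hε => ?_⟩
  have hS : 0 ≤ ∑ i, ‖y i‖ := Finset.sum_nonneg fun i _ => norm_nonneg _
  set S := ∑ i, ‖y i‖
  obtain ⟨l, hl, hτ⟩ := exists_common_almost_period r (ε := ε / (S + 1)) (by positivity)
  refine ⟨l, hl, fun a ha => ?_⟩
  obtain ⟨τ, hτa, hτε⟩ := hτ a ha
  refine ⟨τ, hτa, fun t _ => ?_⟩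
  rw [← Finset.sum_sub_distrib]
  refine (norm_sum_le _ _).trans ?_
  calc ∑ i, ‖char (r i) (t + τ) • y i - char (r i) t • y i‖
      ≤ ∑ i, ε / (S + 1) * ‖y i‖ := by
        refine Finset.sum_le_sum fun i _ => ?_
        have e : char (r i) (t + τ) - char (r i) t = char (r i) t * (char (r i) τ - 1) := by
          rw [char_add]; ring
        rw [← sub_smul, norm_smul, e, norm_char_mul]
        gcongr
        exact hτε i
    _ = ε / (S + 1) * S := by rw [← Finset.mul_sum]
    _ ≤ ε := by
        rw [div_mul_eq_mul_div, div_le_iff₀ (by positivity)]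
        nlinarith

theorem integral_char_smul_mem_graph [CompleteSpace E] {A : E →ₗ.[ℂ] E} {r : ℝ} {y : E}
    (hy : (y, (Complex.I * (r : ℂ)) • y) ∈ A.graph) (t : ℝ) :
    (∫ s in (0 : ℝ)..t, char r s • y, char r t • y - y) ∈ A.graph := by
  have h1 : (∫ s in (0 : ℝ)..t, char r s) * (Complex.I * r) = char r t - 1 := by
    rw [mul_comm, ← intervalIntegral.integral_const_mul,
      intervalIntegral.integral_eq_sub_of_hasDerivAt (fun s _ => hasDerivAt_char r s)
        ((continuous_const.mul (continuous_char r)).intervalIntegrable _ _), char_zero_right]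
  have h2 := A.graph.smul_mem (∫ s in (0 : ℝ)..t, char r s) hy
  rw [Prod.smul_mk, smul_smul, h1, sub_smul, one_smul] at h2
  rwa [intervalIntegral.integral_smul_const]

theorem exists_eq_sum_of_mem_span_imaginaryEigenvectors {A : E →ₗ.[ℂ] E} {x : E}
    (hx : x ∈ Submodule.span ℂ (imaginaryEigenvectors A)) :
    ∃ (n : ℕ) (r : Fin n → ℝ) (y : Fin n → E),
      (∀ i, (y i, (Complex.I * (r i : ℂ)) • y i) ∈ A.graph) ∧ x = ∑ i, y i := by
  obtain ⟨n, c, g, rfl⟩ := Submodule.mem_span_set'.1 hx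
  choose r hr using fun i => (g i).2.2
  refine ⟨n, r, fun i => c i • (g i : E), fun i => ?_, rfl⟩
  rw [smul_comm]
  exact A.graph.smul_mem (c i) (hr i)

theorem isSubspaceAlmostPeriodic_span_imaginaryEigenvectors [CompleteSpace E]
    {𝒢 : TestFun →L[ℂ] (E →L[ℂ] E)} {A : E →ₗ.[ℂ] E} (hA : IsGenerator 𝒢 A) :
    IsSubspaceAlmostPeriodic 𝒢 A (Submodule.span ℂ (imaginaryEigenvectors A)) := by
  have key : ∀ x ∈ Submodule.span ℂ (imaginaryEigenvectors A), ∃ v : ℝ → E,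
      IsAlmostPeriodic v ∧
        ∀ t : ℝ, 0 ≤ t → (∫ s in (0 : ℝ)..t, v s, v t - x) ∈ A.graph := by
    intro x hx
    obtain ⟨n, r, y, hy, rfl⟩ := exists_eq_sum_of_mem_span_imaginaryEigenvectors hx
    refine ⟨_, isAlmostPeriodic_sum_char_smul r y, fun t _ => ?_⟩
    have h := A.graph.sum_mem (t := Finset.univ) fun i _ => integral_char_smul_mem_graph (hy i) t
    rwa [← prod_mk_sum, Finset.sum_sub_distrib, ← intervalIntegral.integral_finsetSum] at h
    exact fun i _ => ((continuous_char (r i)).smul continuous_const).intervalIntegrable _ _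
  refine ⟨fun x hx => ?_, fun x hx => ?_⟩
  · obtain ⟨v, hv, hmild⟩ := key x hx
    exact ⟨v, hv.1, hmild⟩
  · obtain ⟨v, hv, hmild⟩ := key x hx
    exact ⟨v, fun t ht => mem_graphG_dirac_of_mild_solution hA hv.1 hmild ht, hv⟩

end CDistSemigroup

theorem proposition2p6 {E : Type*} [NormedAddCommGroup E] [NormedSpace ℂ E] [CompleteSpace E]
    (C : E →L[ℂ] E) (hC : Function.Injective C)
    (𝒢 : CDistSemigroup.TestFun →L[ℂ] (E →L[ℂ] E))
    (h𝒢 : CDistSemigroup.IsCDistSemigroup C 𝒢)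
    (A : E →ₗ.[ℂ] E) (hA : CDistSemigroup.IsGenerator 𝒢 A)
    (V : Submodule ℂ E) (hV : CDistSemigroup.IsSubspaceWeaklyAlmostPeriodic 𝒢 A V)
    (hVdense : Dense (V : Set E))
    (hE : CDistSemigroup.IsWeaklySequentiallyComplete E) :
    Dense (Submodule.span ℂ (CDistSemigroup.imaginaryEigenvectors A) : Set E) ∧
      CDistSemigroup.IsSubspaceAlmostPeriodic 𝒢 A
        (Submodule.span ℂ (CDistSemigroup.imaginaryEigenvectors A)) :=
  ⟨CDistSemigroup.dense_span_imaginaryEigenvectors h𝒢 hA hV hVdense hE,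
    CDistSemigroup.isSubspaceAlmostPeriodic_span_imaginaryEigenvectors hA⟩
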